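/- Let $\Bbbk$ be a field and let $\mathcal W$ be a finite Weyl group with (directed) Dynkin diagram on the vertices $1,\dots,n$, Cartan matrix $(a_{rs})$ and Coxeter generators $\sigma_1,\dots,\sigma_n$. Here $a_{rr}=2$, and for $r\ne s$ the pair $(a_{rs},a_{sr})$ is $(0,0)$ if $r,s$ are not joined, $(-1,-1)$ for a single edge, $(-2,-1)$ for a double edge with arrow from $r$ to $s$, and $(-3,-1)$ for a triple edge with arrow from $r$ to $s$. Let $\mathcal W$ act on $\Bbbk[x]=\Bbbk[x_1,\dots,x_n]$ by algebra automorphisms with $\sigma_r(x_s)=x_s-a_{sr}x_r$, put $\partial_r(f)=(\sigma_r(f)-f)/x_r$, let $Z=\Bbbk[x]^{\mathcal W}$, let $F$ be the quotient field of $Z$, and let $\Bbbk(x)$ be the quotient field of $\Bbbk[x]$. Let $\mathcal H$ be the degenerate affine Hecke algebra: the unital $\Bbbk$-algebra with generators $x_r,t_r$ $(1\le r\le n)$ and relations $x_rx_s=x_sx_r$; $t_rx_s=\sigma_r(x_s)t_r+\partial_r(x_s)$; $t_r^2=1$; $t_rt_s=t_st_r$ if $r,s$ are not joined; $t_rt_st_r=t_st_rt_s$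 if $r,s$ are joined by a single edge; $(t_rt_s)^2=(t_st_r)^2$ if they are joined by a double edge; $(t_rt_s)^3=(t_st_r)^3$ if they are joined by a triple edge. The image of $Z$ in $\mathcal H$ is central; let $\mathcal H_F=\mathcal H\otimes_Z F$, let $\Bbbk(x)\cong\Bbbk[x]\otimes_Z F\to\mathcal H_F$ be the natural map, and put $\phi_r=t_r+x_r^{-1}\in\mathcal H_F$. Then: (1) The $\Bbbk$-algebra $\mathcal H_F$ is generated by the elements $x_1,\dots,x_n$, $\phi_1,\dots,\phi_n$ and $f^{-1}$ $(0\ne f\in\Bbbk[x])$, subject to the following defining relations: $x_rx_s=x_sx_r$; $ff^{-1}=f^{-1}f=1$ for all $0\neq f\in\Bbbk[x]$; $\phi_rx_s=\sigma_r(x_s)\phi_r$; $\phi_r^2=1-x_r^{-2}$; $\phi_r\phi_s=\phi_s\phi_r$ if $r,s$ are not joined; $\phi_r\phi_s\phi_r=\phi_s\phi_r\phi_s$ if $r,s$ are joined by a single edge; $(\phi_r\phi_s)^2=(\phi_s\phi_r)^2$ if they are joined by a double edge; $(\phi_r\phi_s)^3=(\phi_s\phi_r)^3$ if they are joined by a triple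 edge. (2) For $w\in\mathcal W$ with reduced expression $w=\sigma_{r_1}\cdots\sigma_{r_m}$ the element $\phi_w=\phi_{r_1}\cdots\phi_{r_m}\in\mathcal H_F$ does not depend on the reduced expression, and $\{\phi_w\mid w\in\mathcal W\}$ is a basis of $\mathcal H_F$ both as a left and as a right $\Bbbk(x)$-vector space: $$\mathcal H_F=\bigoplus_{w\in\mathcal W}\Bbbk(x)\phi_w=\bigoplus_{w\in\mathcal W}\phi_w\Bbbk(x).$$ -/

import Mathlib

open scoped TensorProduct

namespace DegenerateAffineHecke

noncomputable section

/-- A directed Dynkin diagram on the vertices `0, …, n-1`, given by its Cartan matrix.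
For `r ≠ s` the pair `(a r s, a s r)` is `(0, 0)` (no edge), `(-1, -1)` (single edge),
`(-2, -1)` (double edge with an arrow from `r` to `s`), `(-3, -1)` (triple edge with an arrow
from `r` to `s`), or one of the two transposed pairs. That the associated Coxeter group is a
Weyl group, i.e. that it is finite, is a separate hypothesis `[Finite D.W]`. -/
structure DynkinDiagram (n : ℕ) where
  a : Matrix (Fin n) (Fin n) ℤ
  diag : ∀ r, a r r = 2
  offDiag : ∀ r s, r ≠ s →
    (a r s = 0 ∧ a s r = 0) ∨ (a r s = -1 ∧ a s r = -1) ∨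
    (a r s = -2 ∧ a s r = -1) ∨ (a r s = -1 ∧ a s r = -2) ∨
    (a r s = -3 ∧ a s r = -1) ∨ (a r s = -1 ∧ a s r = -3)

/-- The order of `σ_r σ_s` for `r ≠ s`, as a function of the product `a r s * a s r`. -/
def bondOrder (p : ℤ) : ℕ :=
  if p = 0 then 2 else if p = 1 then 3 else if p = 2 then 4 else if p = 3 then 6 else 0

theorem bondOrder_ne_one (p : ℤ) : bondOrder p ≠ 1 := by
  unfold bondOrder
  split_ifs <;> decide

namespace DynkinDiagram

variable {n : ℕ} (D : DynkinDiagram n)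

/-- The Coxeter matrix of the diagram. -/
def coxeterMatrix : CoxeterMatrix (Fin n) where
  M := Matrix.of fun r s => if r = s then 1 else bondOrder (D.a r s * D.a s r)
  isSymm := by
    ext r s
    simp only [Matrix.transpose_apply, Matrix.of_apply, eq_comm (a := s) (b := r),
      mul_comm (D.a s r)]
  diagonal := by simp
  off_diagonal := by
    intro r s h
    simpa [h] using bondOrder_ne_one _

/-- The Weyl group of the diagram, as the Coxeter group with generators `σ_r`. -/
abbrev W : Type := D.coxeterMatrix.Group

/-- The Coxeter system formed by `D.W` and the generators `σ_r`. -/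
abbrev cs : CoxeterSystem D.coxeterMatrix D.W := D.coxeterMatrix.toCoxeterSystem

end DynkinDiagram

variable (k : Type*) [Field k] {n : ℕ} (D : DynkinDiagram n)

/-- The algebra endomorphism `x_s ↦ x_s - a_{sr} x_r` of the polynomial ring. -/
def reflHom (r : Fin n) : MvPolynomial (Fin n) k →ₐ[k] MvPolynomial (Fin n) k :=
  MvPolynomial.aeval fun s =>
    MvPolynomial.X s - (D.a s r : MvPolynomial (Fin n) k) * MvPolynomial.X r

theorem reflHom_X (r s : Fin n) : reflHom k D r (MvPolynomial.X s) =
    MvPolynomial.X s - (D.a s r : MvPolynomial (Fin n) k) * MvPolynomial.X r := by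
  simp [reflHom]

theorem reflHom_comp_self (r : Fin n) :
    (reflHom k D r).comp (reflHom k D r) = AlgHom.id k (MvPolynomial (Fin n) k) := by
  ext1 u
  simp only [AlgHom.comp_apply, reflHom_X, map_sub, map_mul, map_intCast, D.diag,
    AlgHom.id_apply]
  push_cast
  ring

/-- The algebra automorphism `σ_r` of the polynomial ring. -/
def reflEquiv (r : Fin n) : MvPolynomial (Fin n) k ≃ₐ[k] MvPolynomial (Fin n) k :=
  AlgEquiv.ofAlgHom (reflHom k D r) (reflHom k D r) (reflHom_comp_self k D r)
    (reflHom_comp_self k D r)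

theorem reflEquiv_X (r s : Fin n) : reflEquiv k D r (MvPolynomial.X s) =
    MvPolynomial.X s - (D.a s r : MvPolynomial (Fin n) k) * MvPolynomial.X r :=
  reflHom_X k D r s

theorem algEquiv_ext_X {f g : MvPolynomial (Fin n) k ≃ₐ[k] MvPolynomial (Fin n) k}
    (h : ∀ u, f (MvPolynomial.X u) = g (MvPolynomial.X u)) : f = g := by
  have : (f : MvPolynomial (Fin n) k →ₐ[k] MvPolynomial (Fin n) k) = g := by
    ext1 u
    exact h u
  exact AlgEquiv.ext fun p => DFunLike.congr_fun this p

theorem reflEquiv_isLiftable : D.coxeterMatrix.IsLiftable (reflEquiv k D) := by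
  intro r s
  apply algEquiv_ext_X
  intro u
  by_cases hrs : r = s
  · subst hrs
    simp only [CoxeterMatrix.diagonal, pow_one, AlgEquiv.mul_apply, reflEquiv_X, map_sub,
      map_mul, map_intCast, D.diag, AlgEquiv.one_apply]
    push_cast
    ring
  · have hM : D.coxeterMatrix r s = bondOrder (D.a r s * D.a s r) := by
      change (if r = s then 1 else bondOrder (D.a r s * D.a s r)) = _
      rw [if_neg hrs]
    rw [hM]
    have step : ∀ (m : ℕ) (c d : ℤ),
        ((reflEquiv k D r * reflEquiv k D s) ^ m) (MvPolynomial.X u) =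
          MvPolynomial.X u + (c : MvPolynomial (Fin n) k) * MvPolynomial.X r
            + (d : MvPolynomial (Fin n) k) * MvPolynomial.X s →
        ((reflEquiv k D r * reflEquiv k D s) ^ (m + 1)) (MvPolynomial.X u) =
          MvPolynomial.X u
            + ((D.a s r * D.a u s - D.a u r + c * (D.a r s * D.a s r - 1) + d * D.a s r : ℤ) :
                MvPolynomial (Fin n) k) * MvPolynomial.X r
            + ((-D.a u s - c * D.a r s - d : ℤ) : MvPolynomial (Fin n) k)
                * MvPolynomial.X s := by
      intro m c d h
      rw [pow_succ', AlgEquiv.mul_apply, h, AlgEquiv.mul_apply]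
      simp only [map_add, map_mul, map_intCast, reflEquiv_X, map_sub, D.diag]
      push_cast
      ring
    have s1 := step 0 0 0 (by simp)
    have s2 := step _ _ _ s1
    have s3 := step _ _ _ s2
    have s4 := step _ _ _ s3
    have s5 := step _ _ _ s4
    have s6 := step _ _ _ s5
    rcases D.offDiag r s hrs with h | h | h | h | h | h <;> obtain ⟨h1, h2⟩ := h <;>
      rw [h1, h2] at s1 s2 s3 s4 s5 s6 ⊢
    · rw [show bondOrder (0 * 0) = 2 by decide, s2, AlgEquiv.one_apply]
      push_cast
      ring
    · rw [show bondOrder (-1 * -1) = 3 by decide, s3, AlgEquiv.one_apply]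
      push_cast
      ring
    · rw [show bondOrder (-2 * -1) = 4 by decide, s4, AlgEquiv.one_apply]
      push_cast
      ring
    · rw [show bondOrder (-1 * -2) = 4 by decide, s4, AlgEquiv.one_apply]
      push_cast
      ring
    · rw [show bondOrder (-3 * -1) = 6 by decide, s6, AlgEquiv.one_apply]
      push_cast
      ring
    · rw [show bondOrder (-1 * -3) = 6 by decide, s6, AlgEquiv.one_apply]
      push_cast
      ring

/-- The left action of the Weyl group on the polynomial ring by algebra automorphisms,
`σ_r(x_s) = x_s - a_{sr} x_r`. -/
def weylAct : D.W →* (MvPolynomial (Fin n) k ≃ₐ[k] MvPolynomial (Fin n) k) :=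
  D.cs.lift ⟨reflEquiv k D, reflEquiv_isLiftable k D⟩

theorem weylAct_simple (r : Fin n) : weylAct k D (D.cs.simple r) = reflEquiv k D r :=
  D.cs.lift_apply_simple (reflEquiv_isLiftable k D) r

/-- The subalgebra `Z` of Weyl group invariants in the polynomial ring. -/
def Z : Subalgebra k (MvPolynomial (Fin n) k) where
  carrier := {f | ∀ w : D.W, weylAct k D w f = f}
  mul_mem' := fun hf hg w => by rw [map_mul, hf w, hg w]
  add_mem' := fun hf hg w => by rw [map_add, hf w, hg w]
  algebraMap_mem' := fun c w => AlgEquiv.commutes _ c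

/-- The field `F`, the quotient field of `Z`. -/
def F : Type _ := FractionRing (Z k D)

instance instFieldF : Field (F k D) := inferInstanceAs (Field (FractionRing (Z k D)))

instance instAlgebraZF : Algebra (Z k D) (F k D) :=
  inferInstanceAs (Algebra (Z k D) (FractionRing (Z k D)))

instance instIsFractionRingZF : IsFractionRing (Z k D) (F k D) :=
  inferInstanceAs (IsFractionRing (Z k D) (FractionRing (Z k D)))

/-- The rational function field `k(x)`. -/
abbrev RatFun (k : Type*) [Field k] (n : ℕ) : Type _ := FractionRing (MvPolynomial (Fin n) k)

/-! ### The degenerate affine Hecke algebra -/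

/-- The generators of the degenerate affine Hecke algebra. -/
inductive HGen (n : ℕ) : Type
  | x (r : Fin n) : HGen n
  | t (r : Fin n) : HGen n

section HRel

/-- The generator `x_r` of the free algebra. -/
abbrev fx (r : Fin n) : FreeAlgebra k (HGen n) := FreeAlgebra.ι k (HGen.x r)

/-- The generator `t_r` of the free algebra. -/
abbrev ft (r : Fin n) : FreeAlgebra k (HGen n) := FreeAlgebra.ι k (HGen.t r)

/-- The defining relations of the degenerate affine Hecke algebra. In `tx`, the coefficient
`x_s - a_{sr} x_r` is `σ_r(x_s)`, and `-a_{sr}` is `∂_r(x_s) = (σ_r(x_s) - x_s) / x_r`. -/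
inductive HRel : FreeAlgebra k (HGen n) → FreeAlgebra k (HGen n) → Prop
  | xx (r s) : HRel (fx k r * fx k s) (fx k s * fx k r)
  | tx (r s) : HRel (ft k r * fx k s)
      ((fx k s - (D.a s r : FreeAlgebra k (HGen n)) * fx k r) * ft k r
        + (-(D.a s r) : FreeAlgebra k (HGen n)))
  | tt (r) : HRel (ft k r ^ 2) 1
  | braid2 (r s) (h : D.a r s = 0) : HRel (ft k r * ft k s) (ft k s * ft k r)
  | braid3 (r s) (h : D.a r s = -1) (h' : D.a s r = -1) :
      HRel (ft k r * ft k s * ft k r) (ft k s * ft k r * ft k s)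
  | braid4 (r s) (h : D.a r s = -2) : HRel ((ft k r * ft k s) ^ 2) ((ft k s * ft k r) ^ 2)
  | braid6 (r s) (h : D.a r s = -3) : HRel ((ft k r * ft k s) ^ 3) ((ft k s * ft k r) ^ 3)

end HRel

/-- The degenerate affine Hecke algebra `H`. -/
def H : Type _ := RingQuot (HRel k D)

instance instRingH : Ring (H k D) := inferInstanceAs (Ring (RingQuot (HRel k D)))

instance instAlgebraH : Algebra k (H k D) := inferInstanceAs (Algebra k (RingQuot (HRel k D)))

/-- The quotient map onto `H`. -/
def H.mk : FreeAlgebra k (HGen n) →ₐ[k] H k D := RingQuot.mkAlgHom k (HRel k D)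

theorem H.mk_rel {a b : FreeAlgebra k (HGen n)} (h : HRel k D a b) : H.mk k D a = H.mk k D b :=
  RingQuot.mkAlgHom_rel k h

theorem H.mk_surjective : Function.Surjective (H.mk k D) :=
  RingQuot.mkAlgHom_surjective k (HRel k D)

/-- The generator `x_r` of `H`. -/
def H.x (r : Fin n) : H k D := H.mk k D (fx k r)

/-- The generator `t_r` of `H`. -/
def H.t (r : Fin n) : H k D := H.mk k D (ft k r)

theorem H.x_comm (r s : Fin n) : H.x k D r * H.x k D s = H.x k D s * H.x k D r := by
  have h := H.mk_rel k D (HRel.xx (k := k) (D := D) r s)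
  rwa [map_mul, map_mul] at h

theorem H.t_mul_x (r s : Fin n) : H.t k D r * H.x k D s =
    (H.x k D s - (D.a s r : H k D) * H.x k D r) * H.t k D r + (-(D.a s r) : H k D) := by
  have h := H.mk_rel k D (HRel.tx (k := k) (D := D) r s)
  simp only [map_mul, map_add, map_sub, map_neg, map_intCast] at h
  exact h

theorem H.x_comm' : ∀ p ∈ Set.range (H.x k D), ∀ q ∈ Set.range (H.x k D), p * q = q * p := by
  rintro _ ⟨r, rfl⟩ _ ⟨s, rfl⟩
  exact H.x_comm k D r s

open scoped IsMulCommutative in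
/-- The algebra homomorphism `k[x] → H` that sends `x_r` to `x_r`. -/
def polyToH : MvPolynomial (Fin n) k →ₐ[k] H k D :=
  haveI := Algebra.isMulCommutative_adjoin k (H.x_comm' k D)
  (Algebra.adjoin k (Set.range (H.x k D))).val.comp
    (MvPolynomial.aeval fun r =>
      (⟨H.x k D r, Algebra.subset_adjoin ⟨r, rfl⟩⟩ : Algebra.adjoin k (Set.range (H.x k D))))

theorem polyToH_X (r : Fin n) : polyToH k D (MvPolynomial.X r) = H.x k D r := by
  simp [polyToH]

theorem t_mul_poly (r : Fin n) (f : MvPolynomial (Fin n) k) :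
    ∃ g : MvPolynomial (Fin n) k, MvPolynomial.X r * g = reflEquiv k D r f - f ∧
      H.t k D r * polyToH k D f =
        polyToH k D (reflEquiv k D r f) * H.t k D r + polyToH k D g := by
  induction f using MvPolynomial.induction_on with
  | C c =>
    refine ⟨0, ?_, ?_⟩
    · rw [← MvPolynomial.algebraMap_eq, AlgEquiv.commutes]; simp
    · rw [← MvPolynomial.algebraMap_eq, AlgEquiv.commutes, AlgHom.commutes, map_zero, add_zero]
      exact (Algebra.commutes c (H.t k D r)).symm
  | add p q hp hq =>
    obtain ⟨g, h1, h2⟩ := hp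
    obtain ⟨g', h1', h2'⟩ := hq
    refine ⟨g + g', ?_, ?_⟩
    · rw [mul_add, h1, h1', map_add]
      ring
    · simp only [map_add, mul_add, add_mul, h2, h2']; abel
  | mul_X p s hp =>
    obtain ⟨g, h1, h2⟩ := hp
    refine ⟨g * MvPolynomial.X s - reflEquiv k D r p * (D.a s r : MvPolynomial (Fin n) k),
      ?_, ?_⟩
    · rw [mul_sub, ← mul_assoc, h1, map_mul, reflEquiv_X]; ring
    · rw [map_mul, map_mul, ← mul_assoc, h2, add_mul, mul_assoc, polyToH_X, H.t_mul_x,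
        reflEquiv_X]
      simp only [map_mul, map_sub, polyToH_X, map_intCast, mul_add, mul_neg, mul_assoc]
      abel

theorem poly_mem_center (f : Z k D) (h : H k D) :
    polyToH k D f * h = h * polyToH k D f := by
  obtain ⟨y, rfl⟩ := H.mk_surjective k D h
  induction y using FreeAlgebra.induction with
  | grade0 c =>
    rw [AlgHom.commutes]
    exact (Algebra.commutes c _).symm
  | grade1 g =>
    cases g with
    | x r =>
      change _ * H.x k D r = H.x k D r * _
      rw [← polyToH_X, ← map_mul, ← map_mul, mul_comm]
    | t r =>
      change _ * H.t k D r = H.t k D r * _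
      obtain ⟨g, h1, h2⟩ := t_mul_poly k D r f
      have hf : reflEquiv k D r f = f := by
        rw [← weylAct_simple]
        exact f.2 _
      rw [hf, sub_self] at h1
      have hg : g = 0 := (mul_eq_zero.mp h1).resolve_left (MvPolynomial.X_ne_zero r)
      rw [h2, hf, hg, map_zero, add_zero]
  | mul a b ha hb => rw [map_mul, ← mul_assoc, ha, mul_assoc, hb, mul_assoc]
  | add a b ha hb => rw [map_add, mul_add, add_mul, ha, hb]

/-- `H` is a `Z`-algebra through `Z ⊆ k[x] → H`. -/
instance instAlgebraZH : Algebra (Z k D) (H k D) :=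
  ((polyToH k D : MvPolynomial (Fin n) k →+* H k D).comp
    (algebraMap (Z k D) (MvPolynomial (Fin n) k))).toAlgebra' (poly_mem_center k D)

instance instIsScalarTowerZH : IsScalarTower k (Z k D) (H k D) :=
  IsScalarTower.of_algebraMap_eq fun c => ((polyToH k D).commutes c).symm

/-- `k[x] → H` as a homomorphism of `Z`-algebras. -/
def polyToHZ : MvPolynomial (Fin n) k →ₐ[Z k D] H k D :=
  { (polyToH k D : MvPolynomial (Fin n) k →+* H k D) with commutes' := fun _ => rfl }

/-! ### The rationalization -/

/-- The rationalization `H_F = H ⊗_Z F`. -/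
abbrev HF : Type _ := H k D ⊗[Z k D] F k D

theorem isUnit_poly [Finite D.W] (f : nonZeroDivisors (MvPolynomial (Fin n) k)) :
    IsUnit ((Algebra.TensorProduct.includeLeftRingHom :
      MvPolynomial (Fin n) k →+* MvPolynomial (Fin n) k ⊗[Z k D] F k D) f) := by
  classical
  obtain ⟨f, hf⟩ := f
  have hf0 : f ≠ 0 := nonZeroDivisors.ne_zero hf
  let _ := Fintype.ofFinite D.W
  let N : MvPolynomial (Fin n) k := ∏ w : D.W, weylAct k D w f
  have hN : N ∈ Z k D := by
    intro v
    change weylAct k D v (∏ w : D.W, weylAct k D w f) = ∏ w : D.W, weylAct k D w f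
    rw [map_prod]
    refine Fintype.prod_equiv (Equiv.mulLeft v) _ _ fun w => ?_
    simp [map_mul]
  have hN0 : (⟨N, hN⟩ : Z k D) ≠ 0 := by
    intro h
    have : N = 0 := congrArg Subtype.val h
    obtain ⟨w, -, hw⟩ := Finset.prod_eq_zero_iff.mp this
    exact hf0 ((map_eq_zero_iff _ (weylAct k D w).injective).mp hw)
  have hdvd : f ∣ N := by
    have := Finset.dvd_prod_of_mem (fun w : D.W => weylAct k D w f) (Finset.mem_univ 1)
    simpa using this
  obtain ⟨g, hg⟩ := hdvd
  refine IsUnit.of_mul_eq_one (g ⊗ₜ[Z k D] (algebraMap (Z k D) (F k D) ⟨N, hN⟩)⁻¹) ?_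
  have hne : algebraMap (Z k D) (F k D) ⟨N, hN⟩ ≠ 0 :=
    (map_ne_zero_iff _ (IsFractionRing.injective (Z k D) (F k D))).mpr hN0
  have hsm : f * g = (⟨N, hN⟩ : Z k D) • (1 : MvPolynomial (Fin n) k) := by
    rw [Algebra.smul_def, mul_one, ← hg]
    rfl
  change (f ⊗ₜ[Z k D] (1 : F k D)) * _ = 1
  rw [Algebra.TensorProduct.tmul_mul_tmul, one_mul, hsm, TensorProduct.smul_tmul,
    Algebra.smul_def, mul_inv_cancel₀ hne, Algebra.TensorProduct.one_def]

/-- The natural map `k(x) → k[x] ⊗_Z F`, the inverse of `f ⊗ g ↦ f g`. -/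
def ratToTensor [Finite D.W] : RatFun k n →+* MvPolynomial (Fin n) k ⊗[Z k D] F k D :=
  IsLocalization.lift (M := nonZeroDivisors (MvPolynomial (Fin n) k)) (isUnit_poly k D)

/-- The natural map `k(x) → H_F`: the identification of `k(x)` with `k[x] ⊗_Z F` followed by
`k[x] ⊗_Z F → H ⊗_Z F`. It is the only ring homomorphism that sends each polynomial `f` to
`f ⊗ 1`. -/
def ratToHF [Finite D.W] : RatFun k n →+* HF k D :=
  (Algebra.TensorProduct.map (polyToHZ k D) (AlgHom.id (Z k D) (F k D))).toRingHom.comp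
    (ratToTensor k D)

theorem ratToHF_algebraMap [Finite D.W] (f : MvPolynomial (Fin n) k) :
    ratToHF k D (algebraMap _ (RatFun k n) f) = polyToH k D f ⊗ₜ[Z k D] (1 : F k D) := by
  have : ratToTensor k D (algebraMap _ (RatFun k n) f) = f ⊗ₜ[Z k D] (1 : F k D) :=
    IsLocalization.lift_eq _ f
  change Algebra.TensorProduct.map (polyToHZ k D) (AlgHom.id (Z k D) (F k D))
    (ratToTensor k D (algebraMap _ (RatFun k n) f)) = _
  rw [this]
  rfl

/-- The element `x_r` of `H_F`. -/
def HF.x (r : Fin n) : HF k D := H.x k D r ⊗ₜ[Z k D] (1 : F k D)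

/-- The element `t_r` of `H_F`. -/
def HF.t (r : Fin n) : HF k D := H.t k D r ⊗ₜ[Z k D] (1 : F k D)

/-- The element `f⁻¹` of `H_F`, for a polynomial `f` (used only for `f ≠ 0`). -/
def HF.polyInv [Finite D.W] (f : MvPolynomial (Fin n) k) : HF k D :=
  ratToHF k D (algebraMap _ (RatFun k n) f)⁻¹

/-- The intertwining element `φ_r = t_r + x_r⁻¹` of `H_F`. -/
def HF.phi [Finite D.W] (r : Fin n) : HF k D :=
  HF.t k D r + HF.polyInv k D (MvPolynomial.X r)

/-! ### The algebra given by the second presentation -/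

/-- The generators `x_r`, `φ_r` and `f⁻¹` for `0 ≠ f ∈ k[x]`. -/
inductive IGen (k : Type*) [Field k] (n : ℕ) : Type _
  | x (r : Fin n) : IGen k n
  | phi (r : Fin n) : IGen k n
  | inv (f : MvPolynomial (Fin n) k) (hf : f ≠ 0) : IGen k n

section IRel

/-- The generator `x_r` of the free algebra. -/
abbrev gx (r : Fin n) : FreeAlgebra k (IGen k n) := FreeAlgebra.ι k (IGen.x r)

/-- The generator `φ_r` of the free algebra. -/
abbrev gphi (r : Fin n) : FreeAlgebra k (IGen k n) := FreeAlgebra.ι k (IGen.phi r)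

/-- The generator `f⁻¹` of the free algebra. -/
abbrev ginv (f : MvPolynomial (Fin n) k) (hf : f ≠ 0) : FreeAlgebra k (IGen k n) :=
  FreeAlgebra.ι k (IGen.inv f hf)

/-- The polynomial `f` written in the generators `x_r` of the free algebra, the variables of
each monomial being multiplied in increasing order. (The order does not matter once the `x_r`
commute.) -/
def gpoly (f : MvPolynomial (Fin n) k) : FreeAlgebra k (IGen k n) :=
  ∑ m ∈ f.support, f.coeff m • (List.ofFn fun r => gx k r ^ m r).prod

/-- The relations between the generators `x_r`, `φ_r`, `f⁻¹`. -/
inductive IRel : FreeAlgebra k (IGen k n) → FreeAlgebra k (IGen k n) → Prop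
  | xx (r s) : IRel (gx k r * gx k s) (gx k s * gx k r)
  | mul_inv (f) (hf : f ≠ 0) : IRel (gpoly k f * ginv k f hf) 1
  | inv_mul (f) (hf : f ≠ 0) : IRel (ginv k f hf * gpoly k f) 1
  | phix (r s) : IRel (gphi k r * gx k s)
      ((gx k s - (D.a s r : FreeAlgebra k (IGen k n)) * gx k r) * gphi k r)
  | phiphi (r) : IRel (gphi k r ^ 2)
      (1 - ginv k (MvPolynomial.X r) (MvPolynomial.X_ne_zero r) ^ 2)
  | braid2 (r s) (h : D.a r s = 0) : IRel (gphi k r * gphi k s) (gphi k s * gphi k r)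
  | braid3 (r s) (h : D.a r s = -1) (h' : D.a s r = -1) :
      IRel (gphi k r * gphi k s * gphi k r) (gphi k s * gphi k r * gphi k s)
  | braid4 (r s) (h : D.a r s = -2) :
      IRel ((gphi k r * gphi k s) ^ 2) ((gphi k s * gphi k r) ^ 2)
  | braid6 (r s) (h : D.a r s = -3) :
      IRel ((gphi k r * gphi k s) ^ 3) ((gphi k s * gphi k r) ^ 3)

end IRel

/-- The `k`-algebra with generators `x_r`, `φ_r`, `f⁻¹` and the relations above. -/
def Presented : Type _ := RingQuot (IRel k D)

instance instRingPresented : Ring (Presented k D) := inferInstanceAs (Ring (RingQuot (IRel k D)))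

instance instAlgebraPresented : Algebra k (Presented k D) :=
  inferInstanceAs (Algebra k (RingQuot (IRel k D)))

/-- The quotient map onto the presented algebra. -/
def Presented.mk : FreeAlgebra k (IGen k n) →ₐ[k] Presented k D := RingQuot.mkAlgHom k (IRel k D)

/-- The class of a generator in the presented algebra. -/
def Presented.gen (g : IGen k n) : Presented k D :=
  Presented.mk k D (FreeAlgebra.ι k g)

end

end DegenerateAffineHecke

/-!
The Hecke algebra acts on the left vector space `k(x) ⊗ k[W]` over the rational functions by
`t_r (f ⊗ w) = σ_r(f) ⊗ σ_r w + ∂_r(f) ⊗ w`. The quadratic relation and the relation between `t_r`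
and the coordinates are computations. The difference of the two sides of a braid relation kills
the vectors `1 ⊗ w`, because `W` satisfies the braid relations, and it intertwines the coordinates
with an automorphism of `k(x)`, because the terms of lower order cancel. So it is zero
(`eq_zero_of_intertwine`, `isBraided_opT`). This makes `k(x) ⊗ k[W]` a representation of `H_F`
(`ratRep`). The elements `t_w` span `H_F` over `k(x)` and take `1 ⊗ 1` to the vectors `1 ⊗ w`, hence
they are a basis of `H_F`, and the representation is faithful. The argument does not need that `W`
acts faithfully on `k(x)`, which can fail in characteristic two.

The braid relations of the `φ_r` can therefore be checked in the representation. There, `x_r φ_r` is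
up to `σ_r` the operator `x_r ⊗ σ_r + 1`, and its braid relations are the Yang-Baxter equations of
rank two, which are polynomial identities (`isBraided_opPsi`). The factors `x_r⁻¹` do not affect
braid relations, since both sides acquire the product over the positive roots of rank two
(`IsBraided.twist`). For the same reason the normalized elements `(1 + x_r⁻¹)⁻¹ φ_r` satisfy the
braid relations. They are involutions, because `φ_r² = (1 + x_r⁻¹) (1 - x_r⁻¹)`, and so they generate
a copy of `W` (`IsIntertwinerSystem.weylHom`). Its elements span `H_F` over `k(x)`, and by comparison
with the basis `t_w` they are a basis (`expand_weylHom_bijective`). A product of the `φ_r` is a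
nonzero rational multiple of a normalized element (`IsIntertwinerSystem.prod_map_eq`), so the `φ_w`
are a basis too, on either side. For a reduced expression of `w`, the multiple is the coefficient of
the leading term of `t_w` with respect to the length, so it does not depend on the expression
(`IsIntertwinerSystem.prod_map_eq_of_isReduced`); this avoids Matsumoto's theorem.

The construction of the normalized elements uses only the relations of the presented algebra, so it
is spanned by such elements as well. Their images are a basis of `H_F`, and the homomorphism from the
presented algebra to `H_F` is bijective (`presentedToHF_bijective`).
-/

namespace DegenerateAffineHecke

/-! ### Braid relations -/

section Braid

variable {n : ℕ} {D : DynkinDiagram n}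

namespace DynkinDiagram

theorem ne_of_a_ne_two {r s : Fin n} (h : D.a r s ≠ 2) : r ≠ s := by
  rintro rfl
  exact h (D.diag r)

theorem a_eq_zero_symm {r s : Fin n} (h : D.a r s = 0) : D.a s r = 0 := by
  have := D.offDiag r s (D.ne_of_a_ne_two (by omega))
  omega

theorem a_eq_neg_one_of_neg_two {r s : Fin n} (h : D.a r s = -2) : D.a s r = -1 := by
  have := D.offDiag r s (D.ne_of_a_ne_two (by omega))
  omega

theorem a_eq_neg_one_of_neg_three {r s : Fin n} (h : D.a r s = -3) : D.a s r = -1 := by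
  have := D.offDiag r s (D.ne_of_a_ne_two (by omega))
  omega

theorem coxeterMatrix_apply {r s : Fin n} (h : r ≠ s) :
    D.coxeterMatrix r s = bondOrder (D.a r s * D.a s r) := by
  change (if r = s then 1 else bondOrder (D.a r s * D.a s r)) = _
  rw [if_neg h]

end DynkinDiagram

variable (D) in
/-- A family `g` of elements of a monoid, indexed by the vertices of the diagram, satisfies the
braid relations of the diagram. No condition is put on the squares `g r ^ 2`. -/
structure IsBraided {M : Type*} [Monoid M] (g : Fin n → M) : Prop where
  comm : ∀ r s, D.a r s = 0 → g r * g s = g s * g r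
  single : ∀ r s, D.a r s = -1 → D.a s r = -1 → g r * g s * g r = g s * g r * g s
  double : ∀ r s, D.a r s = -2 → (g r * g s) ^ 2 = (g s * g r) ^ 2
  triple : ∀ r s, D.a r s = -3 → (g r * g s) ^ 3 = (g s * g r) ^ 3

theorem IsBraided.map {M N : Type*} [Monoid M] [Monoid N] {g : Fin n → M} (hg : IsBraided D g)
    (f : M →* N) : IsBraided D fun r => f (g r) where
  comm r s h := by simpa only [map_mul] using congrArg f (hg.comm r s h)
  single r s h h' := by simpa only [map_mul] using congrArg f (hg.single r s h h')
  double r s h := by simpa only [map_mul, map_pow] using congrArg f (hg.double r s h)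
  triple r s h := by simpa only [map_mul, map_pow] using congrArg f (hg.triple r s h)

theorem IsBraided.of_map {M N : Type*} [Monoid M] [Monoid N] {g : Fin n → M} {f : M →* N}
    (hf : Function.Injective f) (hg : IsBraided D fun r => f (g r)) : IsBraided D g where
  comm r s h := hf <| by simpa only [map_mul] using hg.comm r s h
  single r s h h' := hf <| by simpa only [map_mul] using hg.single r s h h'
  double r s h := hf <| by simpa only [map_mul, map_pow] using hg.double r s h
  triple r s h := hf <| by simpa only [map_mul, map_pow] using hg.triple r s h

theorem mul_pow_two_mul_eq_one {M : Type*} [Monoid M] {a b : M} (ha : a * a = 1) (hb : b * b = 1)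
    {j : ℕ} (h : (a * b) ^ j = (b * a) ^ j) : (a * b) ^ (2 * j) = 1 := by
  have h1 : (a * b) * (b * a) = 1 := by rw [mul_assoc, ← mul_assoc b, hb, one_mul, ha]
  have h2 : (b * a) * (a * b) = 1 := by rw [mul_assoc, ← mul_assoc a, ha, one_mul, hb]
  have hc : Commute (a * b) (b * a) := h1.trans h2.symm
  rw [two_mul, pow_add]
  nth_rewrite 2 [h]
  rw [← hc.mul_pow, h1, one_pow]

/-- Involutions that satisfy the braid relations satisfy the Coxeter relations. -/
theorem IsBraided.isLiftable {M : Type*} [Monoid M] {g : Fin n → M} (hg : IsBraided D g)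
    (h2 : ∀ r, g r * g r = 1) : D.coxeterMatrix.IsLiftable g := by
  intro r s
  by_cases hrs : r = s
  · subst hrs
    rw [CoxeterMatrix.diagonal, pow_one, h2]
  have hs : ∀ {j : ℕ}, (g s * g r) ^ j = (g r * g s) ^ j → (g r * g s) ^ (2 * j) = 1 :=
    fun h => mul_pow_two_mul_eq_one (h2 r) (h2 s) h.symm
  rw [DynkinDiagram.coxeterMatrix_apply hrs]
  rcases D.offDiag r s hrs with h | h | h | h | h | h <;> obtain ⟨h1, h1'⟩ := h <;> rw [h1, h1']
  · rw [show bondOrder (0 * 0) = 2 * 1 by decide]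
    exact hs (by simpa using (hg.comm r s h1).symm)
  · rw [show bondOrder (-1 * -1) = 3 by decide]
    have h := hg.single r s h1 h1'
    calc (g r * g s) ^ 3 = (g r * g s * g r) * (g s * g r * g s) := by
          simp only [pow_succ, pow_zero, one_mul, mul_assoc]
      _ = g r * (g s * (g r * g r) * g s) * g r := by rw [← h]; simp only [mul_assoc]
      _ = 1 := by rw [h2, mul_one, h2, mul_one, h2]
  · rw [show bondOrder (-2 * -1) = 2 * 2 by decide]
    exact hs (hg.double r s h1).symm
  · rw [show bondOrder (-1 * -2) = 2 * 2 by decide]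
    exact hs (hg.double s r h1')
  · rw [show bondOrder (-3 * -1) = 2 * 3 by decide]
    exact hs (hg.triple r s h1).symm
  · rw [show bondOrder (-1 * -3) = 2 * 3 by decide]
    exact hs (hg.triple s r h1')

variable (D) in
/-- The Coxeter generators satisfy the braid relations. -/
theorem isBraided_simple : IsBraided D D.cs.simple := by
  have key : ∀ r s (j : ℕ), (D.cs.simple r * D.cs.simple s) ^ (2 * j) = 1 →
      (D.cs.simple r * D.cs.simple s) ^ j = (D.cs.simple s * D.cs.simple r) ^ j := by
    intro r s j h
    rw [two_mul, pow_add] at h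
    rw [eq_inv_of_mul_eq_one_left h, ← inv_pow, mul_inv_rev, D.cs.inv_simple, D.cs.inv_simple]
  have hM : ∀ r s, (D.cs.simple r * D.cs.simple s) ^ D.coxeterMatrix r s = 1 :=
    D.cs.simple_mul_simple_pow
  refine ⟨fun r s h => ?_, fun r s h h' => ?_, fun r s h => ?_, fun r s h => ?_⟩
  · have := hM r s
    rw [DynkinDiagram.coxeterMatrix_apply (D.ne_of_a_ne_two (by omega)), h, zero_mul,
      show bondOrder 0 = 2 * 1 by decide] at this
    simpa using key r s 1 this
  · have := hM r s
    rw [DynkinDiagram.coxeterMatrix_apply (D.ne_of_a_ne_two (by omega)), h, h',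
      show bondOrder (-1 * -1) = 3 by decide] at this
    have h3 : (D.cs.simple r * D.cs.simple s * D.cs.simple r) *
        (D.cs.simple s * D.cs.simple r * D.cs.simple s) = 1 := by
      rw [← this]
      simp only [pow_succ, pow_zero, one_mul, mul_assoc]
    rw [eq_inv_of_mul_eq_one_left h3]
    simp only [mul_inv_rev, D.cs.inv_simple, mul_assoc]
  · have := hM r s
    rw [DynkinDiagram.coxeterMatrix_apply (D.ne_of_a_ne_two (by omega)), h,
      D.a_eq_neg_one_of_neg_two h, show bondOrder (-2 * -1) = 2 * 2 by decide] at this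
    exact key r s 2 this
  · have := hM r s
    rw [DynkinDiagram.coxeterMatrix_apply (D.ne_of_a_ne_two (by omega)), h,
      D.a_eq_neg_one_of_neg_three h, show bondOrder (-3 * -1) = 2 * 3 by decide] at this
    exact key r s 3 this

end Braid

/-! ### The action of the Weyl group on rational functions -/

section RationalAction

variable (k : Type*) [Field k] {n : ℕ} (D : DynkinDiagram n)

/-- The action of the Weyl group on `k(x)` that extends the one on `k[x]`. -/
noncomputable def ratAct : D.W →* (RatFun k n ≃+* RatFun k n) where
  toFun w := IsFractionRing.ringEquivOfRingEquiv (weylAct k D w).toRingEquiv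
  map_one' := by
    rw [map_one]
    exact IsFractionRing.ringEquivOfRingEquiv_refl
  map_mul' v w := by
    rw [map_mul]
    exact IsFractionRing.ringEquivOfRingEquiv_comp _ _ _ (weylAct k D w).toRingEquiv
      (weylAct k D v).toRingEquiv

theorem ratAct_algebraMap (w : D.W) (f : MvPolynomial (Fin n) k) :
    ratAct k D w (algebraMap _ (RatFun k n) f) = algebraMap _ (RatFun k n) (weylAct k D w f) :=
  IsFractionRing.ringEquivOfRingEquiv_algebraMap (weylAct k D w).toRingEquiv f

theorem ratAct_mul (v w : D.W) (f : RatFun k n) :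
    ratAct k D (v * w) f = ratAct k D v (ratAct k D w f) := by
  rw [map_mul]
  rfl

theorem ratAct_one (f : RatFun k n) : ratAct k D 1 f = f := by
  rw [map_one]
  rfl

/-- The reflection `σ_r` of `k(x)`. -/
noncomputable abbrev ratRefl (r : Fin n) : RatFun k n ≃+* RatFun k n :=
  ratAct k D (D.cs.simple r)

/-- The coordinate `x_r` as a rational function. -/
noncomputable abbrev ratX (k : Type*) [Field k] {n : ℕ} (r : Fin n) : RatFun k n :=
  algebraMap (MvPolynomial (Fin n) k) (RatFun k n) (MvPolynomial.X r)

theorem ratX_ne_zero (r : Fin n) : ratX k r ≠ 0 :=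
  (map_ne_zero_iff _ (IsFractionRing.injective (MvPolynomial (Fin n) k) (RatFun k n))).mpr
    (MvPolynomial.X_ne_zero r)

theorem one_add_ratX_ne_zero (r : Fin n) : 1 + ratX k r ≠ 0 := by
  rw [← map_one (algebraMap (MvPolynomial (Fin n) k) (RatFun k n)), ← map_add]
  refine (map_ne_zero_iff _
    (IsFractionRing.injective (MvPolynomial (Fin n) k) (RatFun k n))).mpr fun h => ?_
  have := congrArg MvPolynomial.constantCoeff h
  simp at this

theorem ratRefl_algebraMap (r : Fin n) (f : MvPolynomial (Fin n) k) :
    ratRefl k D r (algebraMap _ (RatFun k n) f) =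
      algebraMap _ (RatFun k n) (reflEquiv k D r f) := by
  rw [ratAct_algebraMap, weylAct_simple]

theorem ratRefl_ratX (r s : Fin n) :
    ratRefl k D r (ratX k s) = ratX k s - D.a s r * ratX k r := by
  rw [ratRefl_algebraMap, reflEquiv_X]
  simp

theorem ratRefl_ratX_self (r : Fin n) : ratRefl k D r (ratX k r) = -ratX k r := by
  rw [ratRefl_ratX, D.diag]
  push_cast
  ring

theorem ratRefl_ratRefl (r : Fin n) (f : RatFun k n) : ratRefl k D r (ratRefl k D r f) = f := by
  rw [← ratAct_mul, D.cs.simple_mul_simple_self, ratAct_one]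

theorem isBraided_ratRefl : IsBraided D (ratRefl k D) :=
  (isBraided_simple D).map (ratAct k D)

/-! The action of two reflections on the positive roots of rank two, for each kind of edge. -/

variable {k D} {r s : Fin n}

theorem ratRefl_ratX_of_zero (h : D.a r s = 0) : ratRefl k D s (ratX k r) = ratX k r := by
  rw [ratRefl_ratX, h]
  simp

theorem ratRefl_ratX_of_single (h : D.a r s = -1) (h' : D.a s r = -1) :
    ratRefl k D s (ratX k r) = ratX k r + ratX k s ∧
      ratRefl k D r (ratX k r + ratX k s) = ratX k s := by
  simp only [map_add, ratRefl_ratX, h, h', D.diag]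
  push_cast
  constructor <;> ring

theorem ratRefl_ratX_of_double (h : D.a r s = -2) :
    ratRefl k D s (ratX k r) = ratX k r + 2 * ratX k s ∧
      ratRefl k D r (ratX k s) = ratX k r + ratX k s ∧
      ratRefl k D r (ratX k r + ratX k s) = ratX k s ∧
      ratRefl k D s (ratX k r + ratX k s) = ratX k r + ratX k s ∧
      ratRefl k D r (ratX k r + 2 * ratX k s) = ratX k r + 2 * ratX k s ∧
      ratRefl k D s (ratX k r + 2 * ratX k s) = ratX k r := by
  have h' := D.a_eq_neg_one_of_neg_two h
  simp only [map_add, map_mul, map_ofNat, ratRefl_ratX, h, h', D.diag]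
  push_cast
  refine ⟨?_, ?_, ?_, ?_, ?_, ?_⟩ <;> ring

theorem ratRefl_ratX_of_triple (h : D.a r s = -3) :
    ratRefl k D s (ratX k r) = ratX k r + 3 * ratX k s ∧
      ratRefl k D r (ratX k s) = ratX k r + ratX k s ∧
      ratRefl k D r (ratX k r + ratX k s) = ratX k s ∧
      ratRefl k D s (ratX k r + ratX k s) = ratX k r + 2 * ratX k s ∧
      ratRefl k D r (ratX k r + 2 * ratX k s) = ratX k r + 2 * ratX k s ∧
      ratRefl k D s (ratX k r + 2 * ratX k s) = ratX k r + ratX k s ∧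
      ratRefl k D r (ratX k r + 3 * ratX k s) = 2 * ratX k r + 3 * ratX k s ∧
      ratRefl k D s (ratX k r + 3 * ratX k s) = ratX k r ∧
      ratRefl k D r (2 * ratX k r + 3 * ratX k s) = ratX k r + 3 * ratX k s ∧
      ratRefl k D s (2 * ratX k r + 3 * ratX k s) = 2 * ratX k r + 3 * ratX k s := by
  have h' := D.a_eq_neg_one_of_neg_three h
  simp only [map_add, map_mul, map_ofNat, ratRefl_ratX, h, h', D.diag]
  push_cast
  refine ⟨?_, ?_, ?_, ?_, ?_, ?_, ?_, ?_, ?_, ?_⟩ <;> ring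

end RationalAction

/-! ### Twisting braided families by functions of the roots -/

section Twist

variable {k : Type*} [Field k] {n : ℕ} {D : DynkinDiagram n} {B : Type*} [Ring B]

/-- If a braided family `g` intertwines the reflections, then it stays braided when each `g r` is
multiplied by `U (x_r)`, where `U` commutes with the Weyl group: the two sides of a braid relation
acquire the same factor, the product of the `U β` over the positive roots `β` of rank two. -/
theorem IsBraided.twist {ι : RatFun k n →+* B} {g : Fin n → B} (hg : IsBraided D g)
    (hι : ∀ r f, g r * ι f = ι (ratRefl k D r f) * g r) (U : RatFun k n → RatFun k n)
    (hU : ∀ r f, ratRefl k D r (U f) = U (ratRefl k D r f)) :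
    IsBraided D fun r => ι (U (ratX k r)) * g r := by
  have hι' : ∀ r f b, g r * (ι f * b) = ι (ratRefl k D r f) * (g r * b) := fun r f b => by
    rw [← mul_assoc, hι, mul_assoc]
  have hm : ∀ f f' b, ι f * (ι f' * b) = ι (f * f') * b := fun f f' b => by
    rw [map_mul, mul_assoc]
  have hR : ∀ r f f', ratRefl k D r (f * f') = ratRefl k D r f * ratRefl k D r f' := fun r =>
    map_mul (ratRefl k D r)
  refine ⟨fun r s h => ?_, fun r s h h' => ?_, fun r s h => ?_, fun r s h => ?_⟩
  · have h' := D.a_eq_zero_symm h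
    have hb := hg.comm r s h
    simp only [mul_assoc, hι', hm, hU, ratRefl_ratX_of_zero h, ratRefl_ratX_of_zero h'] at hb ⊢
    rw [hb, mul_comm (U (ratX k r))]
  · have hb := hg.single r s h h'
    obtain ⟨h1, h2⟩ := ratRefl_ratX_of_single (k := k) h h'
    obtain ⟨h3, h4⟩ := ratRefl_ratX_of_single (k := k) h' h
    rw [add_comm] at h3 h4
    simp only [mul_assoc, hι', hm, hU, h1, h2, h3, h4] at hb ⊢
    rw [hb]
    congr 2
    ring
  · have hb := hg.double r s h
    obtain ⟨h1, h2, h3, h4, h5, h6⟩ := ratRefl_ratX_of_double (k := k) h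
    simp only [pow_two, mul_assoc, hι', hm, hR, hU, h1, h2, h3, h4, h5, h6] at hb ⊢
    rw [hb]
    congr 2
    ring
  · have hb := hg.triple r s h
    obtain ⟨h1, h2, h3, h4, h5, h6, h7, h8, h9, h10⟩ := ratRefl_ratX_of_triple (k := k) h
    simp only [pow_succ, pow_zero, one_mul, mul_assoc, hι', hm, hR, hU, h1, h2, h3, h4, h5, h6,
      h7, h8, h9, h10] at hb ⊢
    rw [hb]
    congr 2
    ring

end Twist

/-! ### The braid relations and the coordinates -/

section Straightening

/-! In the following lemmas `S` and `T` stand for `t_r` and `t_s`, `X` and `Y` for `x_r` and `x_s`,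
and `U` for `x_u` with `p = a_{ur}` and `q = a_{us}`. In the difference of the two sides of a braid
relation, the terms of lower order that arise when `U` is moved to the left cancel. -/

variable {K V : Type*} [CommRing K] [AddCommGroup V] [Module K V] {S T : V →+ V} {X Y U : K}
  {p q : ℤ}

theorem straighten_comm
    (hSU : ∀ v, S (U • v) = U • S v - p • X • S v - p • v)
    (hTU : ∀ v, T (U • v) = U • T v - q • Y • T v - q • v)
    (hSY : ∀ v, S (Y • v) = Y • S v) (hTX : ∀ v, T (X • v) = X • T v) (v : V) :
    S (T (U • v)) - T (S (U • v)) = (U - p * X - q * Y) • (S (T v) - T (S v)) := by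
  simp only [map_sub, map_zsmul, hSU, hTU, hSY, hTX]
  module

theorem straighten_single (hS : ∀ v, S (S v) = v) (hT : ∀ v, T (T v) = v)
    (hSU : ∀ v, S (U • v) = U • S v - p • X • S v - p • v)
    (hTU : ∀ v, T (U • v) = U • T v - q • Y • T v - q • v)
    (hSX : ∀ v, S (X • v) = -(X • S v) - (2 : ℤ) • v)
    (hSY : ∀ v, S (Y • v) = Y • S v + X • S v + v)
    (hTX : ∀ v, T (X • v) = X • T v + Y • T v + v)
    (hTY : ∀ v, T (Y • v) = -(Y • T v) - (2 : ℤ) • v) (v : V) :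
    S (T (S (U • v))) - T (S (T (U • v))) =
      (U - (p + q) * (X + Y)) • (S (T (S v)) - T (S (T v))) := by
  simp only [map_sub, map_add, map_zsmul, hS, hT, hSU, hTU, hSX, hSY, hTX, hTY]
  module

theorem straighten_double (hS : ∀ v, S (S v) = v) (hT : ∀ v, T (T v) = v)
    (hSU : ∀ v, S (U • v) = U • S v - p • X • S v - p • v)
    (hTU : ∀ v, T (U • v) = U • T v - q • Y • T v - q • v)
    (hSX : ∀ v, S (X • v) = -(X • S v) - (2 : ℤ) • v)
    (hSY : ∀ v, S (Y • v) = Y • S v + X • S v + v)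
    (hTX : ∀ v, T (X • v) = X • T v + (2 : ℤ) • Y • T v + (2 : ℤ) • v)
    (hTY : ∀ v, T (Y • v) = -(Y • T v) - (2 : ℤ) • v) (v : V) :
    S (T (S (T (U • v)))) - T (S (T (S (U • v)))) =
      (U - (2 * p + q) * X - (2 * p + 2 * q) * Y) •
        (S (T (S (T v))) - T (S (T (S v)))) := by
  simp only [map_sub, map_add, map_neg, map_zsmul, hS, hT, hSU, hTU, hSX, hSY, hTX, hTY]
  module

theorem straighten_triple (hS : ∀ v, S (S v) = v) (hT : ∀ v, T (T v) = v)
    (hSU : ∀ v, S (U • v) = U • S v - p • X • S v - p • v)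
    (hTU : ∀ v, T (U • v) = U • T v - q • Y • T v - q • v)
    (hSX : ∀ v, S (X • v) = -(X • S v) - (2 : ℤ) • v)
    (hSY : ∀ v, S (Y • v) = Y • S v + X • S v + v)
    (hTX : ∀ v, T (X • v) = X • T v + (3 : ℤ) • Y • T v + (3 : ℤ) • v)
    (hTY : ∀ v, T (Y • v) = -(Y • T v) - (2 : ℤ) • v) (v : V) :
    S (T (S (T (S (T (U • v)))))) - T (S (T (S (T (S (U • v)))))) =
      (U - (4 * p + 2 * q) * X - (6 * p + 4 * q) * Y) •
        (S (T (S (T (S (T v))))) - T (S (T (S (T (S v)))))) := by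
  simp only [map_sub, map_add, map_neg, map_zsmul, hS, hT, hSU, hTU, hSX, hSY, hTX, hTY]
  module

end Straightening

/-! ### The induced module of the Hecke algebra -/

section InducedModule

variable (k : Type*) [Field k] {n : ℕ} (D : DynkinDiagram n)

/-- The module `⨁_w k(x) ⊗ w`, which is induced from the regular module of the group algebra
`k[W]`, localized. -/
abbrev IndMod : Type _ := D.W → RatFun k n

variable {k D}

theorem ratRefl_Z_smul (r : Fin n) (z : Z k D) (f : RatFun k n) :
    ratRefl k D r (z • f) = z • ratRefl k D r f := by
  have h : ∀ f : RatFun k n, z • f = algebraMap _ (RatFun k n) (z : MvPolynomial (Fin n) k) * f :=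
    fun f => Algebra.smul_def z f
  rw [h, h, map_mul, ratAct_algebraMap, z.2]

variable (k D)

/-- The action of `t_r` on the induced module: `t_r (f ⊗ w) = σ_r(f) ⊗ σ_r w + ∂_r(f) ⊗ w`. -/
noncomputable def opT (r : Fin n) : Module.End (Z k D) (IndMod k D) where
  toFun v w := ratRefl k D r (v (D.cs.simple r * w)) +
    (ratX k r)⁻¹ * (ratRefl k D r (v w) - v w)
  map_add' v v' := by
    ext w
    simp only [Pi.add_apply, map_add]
    ring
  map_smul' z v := by
    ext w
    simp only [Pi.smul_apply, ratRefl_Z_smul, RingHom.id_apply, smul_add, ← smul_sub,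
      mul_smul_comm]

variable {k D}

theorem opT_apply (r : Fin n) (v : IndMod k D) (w : D.W) :
    opT k D r v w = ratRefl k D r (v (D.cs.simple r * w)) +
      (ratX k r)⁻¹ * (ratRefl k D r (v w) - v w) := rfl

theorem opT_smul (r : Fin n) (f : RatFun k n) (v : IndMod k D) :
    opT k D r (f • v) =
      ratRefl k D r f • opT k D r v + ((ratX k r)⁻¹ * (ratRefl k D r f - f)) • v := by
  ext w
  simp only [opT_apply, Pi.smul_apply, Pi.add_apply, smul_eq_mul, map_mul]
  ring

theorem opT_ratX_smul (r u : Fin n) (v : IndMod k D) :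
    opT k D r (ratX k u • v) =
      ratX k u • opT k D r v - D.a u r • ratX k r • opT k D r v - D.a u r • v := by
  have h : (ratX k r)⁻¹ * (ratRefl k D r (ratX k u) - ratX k u) = -(D.a u r : RatFun k n) := by
    have := ratX_ne_zero (k := k) r
    rw [ratRefl_ratX]
    field_simp
    ring
  rw [opT_smul, h, ratRefl_ratX, sub_smul, mul_smul, neg_smul, Int.cast_smul_eq_zsmul,
    Int.cast_smul_eq_zsmul, ← sub_eq_add_neg]

theorem opT_opT (r : Fin n) (v : IndMod k D) : opT k D r (opT k D r v) = v := by
  ext w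
  have h := ratX_ne_zero (k := k) r
  simp only [opT_apply, map_add, map_mul, map_sub, map_inv₀, ratRefl_ratX_self, ratRefl_ratRefl,
    D.cs.simple_mul_simple_cancel_left, inv_neg]
  ring

theorem opT_single [DecidableEq D.W] (r : Fin n) (w : D.W) :
    opT k D r (Pi.single w 1) = Pi.single (D.cs.simple r * w) 1 := by
  ext v
  have h : D.cs.simple r * v = w ↔ v = D.cs.simple r * w := by
    constructor <;> rintro rfl <;> rw [D.cs.simple_mul_simple_cancel_left]
  simp only [opT_apply, Pi.single_apply, h]
  split_ifs <;> simp

/-- An operator that intertwines the coordinates with their images under `w`, and kills the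
elements `1 ⊗ v`, is zero. -/
theorem eq_zero_of_intertwine [Finite D.W] [DecidableEq D.W]
    {d : Module.End (Z k D) (IndMod k D)} (w : D.W)
    (hX : ∀ u v, d (ratX k u • v) = ratAct k D w (ratX k u) • d v)
    (h1 : ∀ v, d (Pi.single v 1) = 0) : d = 0 := by
  have hp : ∀ (f : MvPolynomial (Fin n) k) v, d (algebraMap _ (RatFun k n) f • v) =
      ratAct k D w (algebraMap _ (RatFun k n) f) • d v := by
    intro f
    induction f using MvPolynomial.induction_on with
    | C c =>
      intro v
      rw [ratAct_algebraMap, ← MvPolynomial.algebraMap_eq, AlgEquiv.commutes]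
      have h : ∀ v : IndMod k D, algebraMap _ (RatFun k n) (algebraMap k (MvPolynomial (Fin n) k) c)
          • v = algebraMap k (Z k D) c • v := fun v => by
        ext w
        exact (Algebra.smul_def (algebraMap k (Z k D) c) (v w)).symm
      rw [h, h, map_smul]
    | add p q hp hq =>
      intro v
      simp only [map_add, add_smul, hp, hq]
    | mul_X p u hp =>
      intro v
      simp only [map_mul, mul_smul, hp]
      rw [hX]
  have hs : ∀ (f : RatFun k n) v, d (f • Pi.single v 1) = 0 := by
    intro f v
    obtain ⟨p, q, hq, rfl⟩ := IsFractionRing.div_surjective (A := MvPolynomial (Fin n) k) f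
    have hq0 : algebraMap (MvPolynomial (Fin n) k) (RatFun k n) q ≠ 0 :=
      (map_ne_zero_iff _ (IsFractionRing.injective (MvPolynomial (Fin n) k) (RatFun k n))).mpr
        (nonZeroDivisors.ne_zero hq)
    have h := hp q ((algebraMap _ (RatFun k n) p / algebraMap _ (RatFun k n) q) • Pi.single v 1)
    rw [← mul_smul, mul_div_cancel₀ _ hq0, hp, h1, smul_zero] at h
    exact (smul_eq_zero_iff_right ((map_ne_zero_iff _ (ratAct k D w).injective).mpr hq0)).mp h.symm
  have := Fintype.ofFinite D.W
  refine LinearMap.ext fun v => ?_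
  have hv : v = ∑ w, v w • Pi.single w (1 : RatFun k n) := by
    ext w
    simp [Finset.sum_apply, Pi.single_apply]
  rw [hv, map_sum, LinearMap.zero_apply]
  exact Finset.sum_eq_zero fun w _ => hs (v w) w

set_option maxRecDepth 2000 in
/-- The operators of the `t_r` satisfy the braid relations. The difference of the two sides of a
braid relation intertwines the coordinates, because the terms of lower order cancel, and it kills
the elements `1 ⊗ w`, because `W` satisfies the braid relations. -/
theorem isBraided_opT [Finite D.W] : IsBraided D (opT k D) := by
  classical
  have hb := isBraided_simple D
  have hz : ∀ {L L' : Module.End (Z k D) (IndMod k D)}, L - L' = 0 → L = L' := sub_eq_zero.mp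
  have hself : ∀ r (v : IndMod k D),
      opT k D r (ratX k r • v) = -(ratX k r • opT k D r v) - (2 : ℤ) • v := fun r v => by
    rw [opT_ratX_smul, D.diag]
    abel
  have hadj : ∀ {r s} (_ : D.a s r = -1) (v : IndMod k D),
      opT k D r (ratX k s • v) = ratX k s • opT k D r v + ratX k r • opT k D r v + v :=
    fun h v => by
      rw [opT_ratX_smul, h]
      abel
  have hrat : ∀ r (c : ℤ) (f f' : RatFun k n), ratRefl k D r (f - c * f') =
      ratRefl k D r f - c * ratRefl k D r f' := fun r c f f' => by
    rw [map_sub, map_mul, map_intCast]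
  refine ⟨fun r s h => ?_, fun r s h h' => ?_, fun r s h => ?_, fun r s h => ?_⟩
  · have h' := D.a_eq_zero_symm h
    refine hz (eq_zero_of_intertwine (D.cs.simple r * D.cs.simple s) (fun u v => ?_) fun w => ?_)
    · refine (straighten_comm (S := (opT k D r).toAddMonoidHom) (T := (opT k D s).toAddMonoidHom)
        (opT_ratX_smul r u) (opT_ratX_smul s u) (fun v => ?_) (fun v => ?_) v).trans
        (congrArg (· • _) ?_)
      · exact (opT_ratX_smul r s v).trans (by simp [h'])
      · exact (opT_ratX_smul s r v).trans (by simp [h])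
      · simp only [ratAct_mul, hrat, ratRefl_ratX, h']
        push_cast
        ring
    · have := congrArg (· * w) (hb.comm r s h)
      simp only [mul_assoc] at this
      simp only [LinearMap.sub_apply, Module.End.mul_apply, opT_single, this, sub_self]
  · refine hz (eq_zero_of_intertwine (D.cs.simple r * D.cs.simple s * D.cs.simple r)
      (fun u v => ?_) fun w => ?_)
    · refine (straighten_single (S := (opT k D r).toAddMonoidHom)
        (T := (opT k D s).toAddMonoidHom) (opT_opT r) (opT_opT s) (opT_ratX_smul r u)
        (opT_ratX_smul s u) (hself r) (hadj h') (hadj h) (hself s) v).trans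
        (congrArg (· • _) ?_)
      simp only [ratAct_mul, hrat, ratRefl_ratX, h, h', D.diag]
      push_cast
      ring
    · have := congrArg (· * w) (hb.single r s h h')
      simp only [mul_assoc] at this
      simp only [LinearMap.sub_apply, Module.End.mul_apply, opT_single, this, sub_self]
  · have h' := D.a_eq_neg_one_of_neg_two h
    refine hz (eq_zero_of_intertwine ((D.cs.simple r * D.cs.simple s) ^ 2)
      (fun u v => ?_) fun w => ?_)
    · simp only [pow_two, LinearMap.sub_apply, Module.End.mul_apply]
      have hTX : ∀ v, opT k D s (ratX k r • v) =
          ratX k r • opT k D s v + (2 : ℤ) • ratX k s • opT k D s v + (2 : ℤ) • v := fun v => by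
        rw [opT_ratX_smul, h, neg_smul, neg_smul, sub_neg_eq_add, sub_neg_eq_add]
      have key := straighten_double (S := (opT k D r).toAddMonoidHom)
        (T := (opT k D s).toAddMonoidHom) (opT_opT r) (opT_opT s) (opT_ratX_smul r u)
        (opT_ratX_smul s u) (hself r) (hadj h') hTX (hself s) v
      simp only [LinearMap.toAddMonoidHom_coe] at key
      rw [key]
      refine congrArg (· • _) ?_
      simp only [ratAct_mul, hrat, ratRefl_ratX, h, h', D.diag]
      push_cast
      ring
    · have := congrArg (· * w) (hb.double r s h)
      simp only [pow_two, mul_assoc] at this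
      simp only [pow_two, LinearMap.sub_apply, Module.End.mul_apply, opT_single, this, sub_self]
  · have h' := D.a_eq_neg_one_of_neg_three h
    refine hz (eq_zero_of_intertwine ((D.cs.simple r * D.cs.simple s) ^ 3)
      (fun u v => ?_) fun w => ?_)
    · simp only [pow_succ, pow_zero, one_mul, LinearMap.sub_apply, Module.End.mul_apply]
      have hTX : ∀ v, opT k D s (ratX k r • v) =
          ratX k r • opT k D s v + (3 : ℤ) • ratX k s • opT k D s v + (3 : ℤ) • v := fun v => by
        rw [opT_ratX_smul, h, neg_smul, neg_smul, sub_neg_eq_add, sub_neg_eq_add]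
      have key := straighten_triple (S := (opT k D r).toAddMonoidHom)
        (T := (opT k D s).toAddMonoidHom) (opT_opT r) (opT_opT s) (opT_ratX_smul r u)
        (opT_ratX_smul s u) (hself r) (hadj h') hTX (hself s) v
      simp only [LinearMap.toAddMonoidHom_coe] at key
      rw [key]
      refine congrArg (· • _) ?_
      simp only [ratAct_mul, hrat, ratRefl_ratX, h, h', D.diag]
      push_cast
      ring
    · have := congrArg (· * w) (hb.triple r s h)
      simp only [pow_succ, pow_zero, one_mul, mul_assoc] at this
      simp only [pow_succ, pow_zero, one_mul, LinearMap.sub_apply, Module.End.mul_apply,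
        opT_single, this, sub_self]

end InducedModule

/-! ### The Yang-Baxter equations of rank two -/

section YangBaxter

/-! In the following lemmas `σ` and `τ` stand for two reflections acting on scalars, `r` and `s` for
their action on the index set by left multiplication, and `X`, `Y`, `P`, … for the positive roots
of rank two. -/

variable {K ι : Type*} [CommRing K] {σ τ : K →+* K} {r s : ι → ι} {X Y P Q R S : K}
  {A B : (ι → K) → ι → K}

theorem yangBaxter_comm (hσY : σ Y = Y) (hτX : τ X = X)
    (hστ : ∀ f, σ (τ f) = τ (σ f)) (hrs : ∀ w, r (s w) = s (r w))
    (hA : ∀ v w, A v w = X * σ (v (r w)) + σ (v w))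
    (hB : ∀ v w, B v w = Y * τ (v (s w)) + τ (v w)) (v : ι → K) (w : ι) :
    A (B v) w = B (A v) w := by
  simp only [hA, hB, map_add, map_mul, hσY, hτX, hστ, hrs]
  ring

theorem yangBaxter_single (hP : P = X + Y) (hσY : σ Y = P) (hσP : σ P = Y) (hτX : τ X = P)
    (hτP : τ P = X) (hστ : ∀ f, σ (τ (σ f)) = τ (σ (τ f)))
    (hr : ∀ w, r (r w) = w) (hs : ∀ w, s (s w) = w) (hrs : ∀ w, r (s (r w)) = s (r (s w)))
    (hA : ∀ v w, A v w = X * σ (v (r w)) + σ (v w))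
    (hB : ∀ v w, B v w = Y * τ (v (s w)) + τ (v w)) (v : ι → K) (w : ι) :
    A (B (A v)) w = B (A (B v)) w := by
  simp only [hA, hB, map_add, map_mul, hσY, hσP, hτX, hτP, hστ, hr, hs, hrs]
  rw [hP]
  ring

theorem yangBaxter_double (hP : P = X + Y) (hQ : Q = X + 2 * Y) (hσY : σ Y = P) (hσP : σ P = Y)
    (hσQ : σ Q = Q) (hτX : τ X = Q) (hτP : τ P = P) (hτQ : τ Q = X)
    (hστ : ∀ f, σ (τ (σ (τ f))) = τ (σ (τ (σ f))))
    (hr : ∀ w, r (r w) = w) (hs : ∀ w, s (s w) = w) (hrs : ∀ w, r (s (r (s w))) = s (r (s (r w))))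
    (hA : ∀ v w, A v w = X * σ (v (r w)) + σ (v w))
    (hB : ∀ v w, B v w = Y * τ (v (s w)) + τ (v w)) (v : ι → K) (w : ι) :
    A (B (A (B v))) w = B (A (B (A v))) w := by
  simp only [hA, hB, map_add, map_mul, hσY, hσP, hσQ, hτX, hτP, hτQ, hστ, hr, hs, hrs]
  rw [hP, hQ]
  ring

theorem yangBaxter_triple (hP : P = X + Y) (hQ : Q = X + 2 * Y) (hR : R = X + 3 * Y)
    (hS : S = 2 * X + 3 * Y) (hσY : σ Y = P) (hσP : σ P = Y) (hσQ : σ Q = Q) (hσR : σ R = S)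
    (hσS : σ S = R) (hτX : τ X = R) (hτP : τ P = Q) (hτQ : τ Q = P) (hτR : τ R = X)
    (hτS : τ S = S) (hστ : ∀ f, σ (τ (σ (τ (σ (τ f))))) = τ (σ (τ (σ (τ (σ f))))))
    (hr : ∀ w, r (r w) = w) (hs : ∀ w, s (s w) = w)
    (hrs : ∀ w, r (s (r (s (r (s w))))) = s (r (s (r (s (r w))))))
    (hA : ∀ v w, A v w = X * σ (v (r w)) + σ (v w))
    (hB : ∀ v w, B v w = Y * τ (v (s w)) + τ (v w)) (v : ι → K) (w : ι) :
    A (B (A (B (A (B v))))) w = B (A (B (A (B (A v))))) w := by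
  simp only [hA, hB, map_add, map_mul, hσY, hσP, hσQ, hσR, hσS, hτX, hτP, hτQ, hτR, hτS, hστ,
    hr, hs, hrs]
  rw [hP, hQ, hR, hS]
  ring

end YangBaxter

/-! ### The intertwining operators on the induced module -/

section Intertwiners

variable (k : Type*) [Field k] {n : ℕ} (D : DynkinDiagram n)

noncomputable instance : Algebra (Z k D) (Module.End (Z k D) (IndMod k D)) :=
  Module.End.instAlgebra _ _ _

noncomputable instance : Module (Z k D) (Module.End (Z k D) (IndMod k D)) :=
  LinearMap.module

noncomputable instance : Algebra k (Module.End (Z k D) (IndMod k D)) :=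
  Module.End.instAlgebra _ _ _

/-- Multiplication by rational functions on the induced module. -/
noncomputable def opMul : RatFun k n →ₐ[Z k D] Module.End (Z k D) (IndMod k D) :=
  Algebra.lsmul (Z k D) (Z k D) (IndMod k D)

/-- The operator of `x_r φ_r = x_r t_r + 1` on the induced module. Up to `σ_r`, it is the
polynomial `x_r ⊗ σ_r + 1` in `k(x) ⊗ k[W]`, and its braid relations are the Yang-Baxter
equations. -/
noncomputable def opPsi (r : Fin n) : Module.End (Z k D) (IndMod k D) where
  toFun v w := ratX k r * ratRefl k D r (v (D.cs.simple r * w)) + ratRefl k D r (v w)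
  map_add' v v' := by
    ext w
    simp only [Pi.add_apply, map_add]
    ring
  map_smul' z v := by
    ext w
    simp only [Pi.smul_apply, ratRefl_Z_smul, RingHom.id_apply, smul_add, mul_smul_comm]

variable {k D}

theorem opMul_apply (f : RatFun k n) (v : IndMod k D) : opMul k D f v = f • v := rfl

theorem opPsi_apply (r : Fin n) (v : IndMod k D) (w : D.W) :
    opPsi k D r v w = ratX k r * ratRefl k D r (v (D.cs.simple r * w)) +
      ratRefl k D r (v w) := rfl

theorem opPsi_mul_opMul (r : Fin n) (f : RatFun k n) :
    opPsi k D r * opMul k D f = opMul k D (ratRefl k D r f) * opPsi k D r := by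
  refine LinearMap.ext fun v => funext fun w => ?_
  simp only [Module.End.mul_apply, opMul_apply, opPsi_apply, Pi.smul_apply, smul_eq_mul, map_mul]
  ring

theorem opMul_inv_mul_opPsi (r : Fin n) :
    opMul k D (ratX k r)⁻¹ * opPsi k D r = opT k D r + opMul k D (ratX k r)⁻¹ := by
  refine LinearMap.ext fun v => funext fun w => ?_
  simp only [Module.End.mul_apply, LinearMap.add_apply, Pi.add_apply, opMul_apply, opPsi_apply,
    opT_apply, Pi.smul_apply, smul_eq_mul]
  have := ratX_ne_zero (k := k) r
  field_simp
  ring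

theorem isBraided_opPsi : IsBraided D (opPsi k D) := by
  have hW := isBraided_simple D
  have hσ := isBraided_ratRefl k D
  have hr : ∀ r w, D.cs.simple r * (D.cs.simple r * w) = w := fun r w =>
    D.cs.simple_mul_simple_cancel_left r
  refine ⟨fun r s h => ?_, fun r s h h' => ?_, fun r s h => ?_, fun r s h => ?_⟩ <;>
    refine LinearMap.ext fun v => funext fun w => ?_
  · have hσ' := DFunLike.congr_fun (hσ.comm r s h)
    have hW' := fun w => congrArg (· * w) (hW.comm r s h)
    simp only [mul_assoc] at hW'
    exact yangBaxter_comm (σ := (ratRefl k D r : _ →+* _)) (τ := (ratRefl k D s : _ →+* _))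
      (ratRefl_ratX_of_zero (D.a_eq_zero_symm h)) (ratRefl_ratX_of_zero h) hσ' hW'
      (opPsi_apply r) (opPsi_apply s) v w
  · obtain ⟨h1, h2⟩ := ratRefl_ratX_of_single (k := k) h h'
    obtain ⟨h3, h4⟩ := ratRefl_ratX_of_single (k := k) h' h
    rw [add_comm] at h3 h4
    have hσ' := DFunLike.congr_fun (hσ.single r s h h')
    have hW' := fun w => congrArg (· * w) (hW.single r s h h')
    simp only [mul_assoc] at hW'
    exact yangBaxter_single (σ := (ratRefl k D r : _ →+* _)) (τ := (ratRefl k D s : _ →+* _))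
      rfl h3 h2 h1 h4 hσ' (hr r) (hr s) hW' (opPsi_apply r) (opPsi_apply s) v w
  · obtain ⟨h1, h2, h3, h4, h5, h6⟩ := ratRefl_ratX_of_double (k := k) h
    have hσ' := DFunLike.congr_fun (hσ.double r s h)
    have hW' := fun w => congrArg (· * w) (hW.double r s h)
    simp only [pow_two, RingAut.mul_apply, mul_assoc] at hσ' hW'
    simp only [pow_two, Module.End.mul_apply]
    exact yangBaxter_double (σ := (ratRefl k D r : _ →+* _)) (τ := (ratRefl k D s : _ →+* _))
      rfl rfl h2 h3 h5 h1 h4 h6 hσ' (hr r) (hr s) hW' (opPsi_apply r) (opPsi_apply s) v w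
  · obtain ⟨h1, h2, h3, h4, h5, h6, h7, h8, h9, h10⟩ := ratRefl_ratX_of_triple (k := k) h
    have hσ' := DFunLike.congr_fun (hσ.triple r s h)
    have hW' := fun w => congrArg (· * w) (hW.triple r s h)
    simp only [pow_succ, pow_zero, one_mul, RingAut.mul_apply, mul_assoc] at hσ' hW'
    simp only [pow_succ, pow_zero, one_mul, Module.End.mul_apply]
    exact yangBaxter_triple (σ := (ratRefl k D r : _ →+* _)) (τ := (ratRefl k D s : _ →+* _))
      rfl rfl rfl rfl h2 h3 h5 h7 h9 h1 h4 h6 h8 h10 hσ' (hr r) (hr s) hW'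
      (opPsi_apply r) (opPsi_apply s) v w

theorem isBraided_opPhi : IsBraided D fun r => opT k D r + opMul k D (ratX k r)⁻¹ := by
  have h : (fun r => (opMul k D : RatFun k n →+* _) (ratX k r)⁻¹ * opPsi k D r) =
      fun r => opT k D r + opMul k D (ratX k r)⁻¹ := funext opMul_inv_mul_opPsi
  rw [← h]
  exact isBraided_opPsi.twist opPsi_mul_opMul (fun f => f⁻¹) fun r => map_inv₀ (ratRefl k D r)

end Intertwiners

/-! ### The induced module as a module over the rationalization -/

section Representation

/-- Two homomorphisms from the rational functions to a ring, which need not be commutative, agree if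
they agree on polynomials. -/
theorem ratFun_ringHom_ext {k : Type*} [Field k] {n : ℕ} {B : Type*} [Ring B]
    {ι ι' : RatFun k n →+* B}
    (h : ∀ p : MvPolynomial (Fin n) k, ι (algebraMap _ _ p) = ι' (algebraMap _ _ p)) : ι = ι' := by
  refine RingHom.ext fun f => ?_
  obtain ⟨p, q, hq, rfl⟩ := IsFractionRing.div_surjective (A := MvPolynomial (Fin n) k) f
  have hq0 : algebraMap (MvPolynomial (Fin n) k) (RatFun k n) q ≠ 0 :=
    IsFractionRing.to_map_ne_zero_of_mem_nonZeroDivisors hq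
  have h1 : ι (algebraMap _ _ q)⁻¹ * ι (algebraMap _ _ q) = 1 := by
    rw [← map_mul, inv_mul_cancel₀ hq0, map_one]
  have h2 : ι (algebraMap _ _ q) * ι' (algebraMap _ _ q)⁻¹ = 1 := by
    rw [h, ← map_mul, mul_inv_cancel₀ hq0, map_one]
  rw [div_eq_mul_inv, map_mul, map_mul, h, left_inv_eq_right_inv h1 h2]

variable (k : Type*) [Field k] {n : ℕ} (D : DynkinDiagram n)

/-- The inclusion of `F`, the field of fractions of the invariants, in `k(x)`. -/
noncomputable def fieldToRat : F k D →ₐ[Z k D] RatFun k n :=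
  IsFractionRing.liftAlgHom (g := Algebra.ofId (Z k D) (RatFun k n)) <|
    (IsFractionRing.injective (MvPolynomial (Fin n) k) (RatFun k n)).comp Subtype.val_injective

theorem ratToHF_fieldToRat [Finite D.W] (c : F k D) :
    ratToHF k D (fieldToRat k D c) = (1 : H k D) ⊗ₜ[Z k D] c := by
  have h : (ratToTensor k D).comp (fieldToRat k D : F k D →+* RatFun k n) =
      ((Algebra.TensorProduct.includeRight :
        F k D →ₐ[Z k D] MvPolynomial (Fin n) k ⊗[Z k D] F k D) : F k D →+* _) := by
    refine IsLocalization.ringHom_ext (nonZeroDivisors (Z k D)) (RingHom.ext fun z => ?_)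
    have h1 : fieldToRat k D (algebraMap (Z k D) (F k D) z) =
        algebraMap _ (RatFun k n) (z : MvPolynomial (Fin n) k) := AlgHom.commutes _ z
    have h2 : ratToTensor k D (algebraMap _ (RatFun k n) (z : MvPolynomial (Fin n) k)) =
        (z : MvPolynomial (Fin n) k) ⊗ₜ[Z k D] (1 : F k D) := IsLocalization.lift_eq _ _
    have h3 : (1 : MvPolynomial (Fin n) k) ⊗ₜ[Z k D] algebraMap (Z k D) (F k D) z =
        (z : MvPolynomial (Fin n) k) ⊗ₜ[Z k D] (1 : F k D) := by
      rw [Algebra.algebraMap_eq_smul_one, ← TensorProduct.smul_tmul, Algebra.smul_def, mul_one]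
      rfl
    exact (congrArg (ratToTensor k D) h1).trans (h2.trans h3.symm)
  have h' : ratToTensor k D (fieldToRat k D c) = 1 ⊗ₜ[Z k D] c := RingHom.congr_fun h c
  change Algebra.TensorProduct.map (polyToHZ k D) (AlgHom.id (Z k D) (F k D))
    (ratToTensor k D (fieldToRat k D c)) = _
  rw [h', Algebra.TensorProduct.map_tmul, map_one, AlgHom.id_apply]

theorem commute_opMul_fieldToRat (a : Module.End (Z k D) (IndMod k D)) (c : F k D) :
    Commute a (opMul k D (fieldToRat k D c)) := by
  obtain ⟨p, q, hq, rfl⟩ := IsFractionRing.div_surjective (A := Z k D) c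
  have hz : ∀ z : Z k D, Commute a (opMul k D (fieldToRat k D (algebraMap _ _ z))) := fun z => by
    rw [AlgHom.commutes, AlgHom.commutes]
    exact (Algebra.commutes z a).symm
  have hu : opMul k D (fieldToRat k D (algebraMap _ _ q)) *
      opMul k D (fieldToRat k D (algebraMap _ _ q)⁻¹) = 1 := by
    rw [← map_mul, ← map_mul, mul_inv_cancel₀, map_one, map_one]
    exact IsFractionRing.to_map_ne_zero_of_mem_nonZeroDivisors hq
  have hu' : opMul k D (fieldToRat k D (algebraMap _ _ q)⁻¹) *
      opMul k D (fieldToRat k D (algebraMap _ _ q)) = 1 := by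
    rw [← map_mul, mul_comm, map_mul, hu]
  rw [div_eq_mul_inv, map_mul, map_mul]
  exact (hz p).mul_right ((hz q).units_inv_right (u := ⟨_, _, hu, hu'⟩))

variable [Finite D.W]

/-- The action of the Hecke algebra on the induced module. -/
noncomputable def heckeRep : H k D →ₐ[k] Module.End (Z k D) (IndMod k D) :=
  RingQuot.liftAlgHom k ⟨FreeAlgebra.lift k fun g => match g with
    | HGen.x r => opMul k D (ratX k r)
    | HGen.t r => opT k D r, fun a b h => by
      have hb := isBraided_opT (k := k) (D := D)
      cases h with
      | xx r s =>
        simp only [map_mul, FreeAlgebra.lift_ι_apply]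
        rw [← map_mul, mul_comm, map_mul]
      | tx r s =>
        simp only [map_mul, map_add, map_sub, map_neg, map_intCast, FreeAlgebra.lift_ι_apply]
        refine LinearMap.ext fun v => ?_
        refine (opT_ratX_smul r s v).trans ?_
        simp only [LinearMap.add_apply, LinearMap.neg_apply, Module.End.mul_apply,
          Module.End.intCast_apply, opMul_apply, sub_eq_add_neg]
      | tt r =>
        simp only [map_pow, map_one, FreeAlgebra.lift_ι_apply]
        exact LinearMap.ext fun v => opT_opT r v
      | braid2 r s h => simpa only [map_mul, FreeAlgebra.lift_ι_apply] using hb.comm r s h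
      | braid3 r s h h' => simpa only [map_mul, FreeAlgebra.lift_ι_apply] using hb.single r s h h'
      | braid4 r s h => simpa only [map_mul, map_pow, FreeAlgebra.lift_ι_apply] using hb.double r s h
      | braid6 r s h => simpa only [map_mul, map_pow, FreeAlgebra.lift_ι_apply] using hb.triple r s h⟩

theorem heckeRep_mk_ι (g : HGen n) : heckeRep k D (H.mk k D (FreeAlgebra.ι k g)) =
    match g with
    | HGen.x r => opMul k D (ratX k r)
    | HGen.t r => opT k D r := by
  refine (RingQuot.liftAlgHom_mkAlgHom_apply k _ _ _).trans ?_
  rw [FreeAlgebra.lift_ι_apply]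

theorem heckeRep_t (r : Fin n) : heckeRep k D (H.t k D r) = opT k D r := heckeRep_mk_ι k D _

theorem heckeRep_polyToH (f : MvPolynomial (Fin n) k) :
    heckeRep k D (polyToH k D f) = opMul k D (algebraMap _ (RatFun k n) f) := by
  have h : ∀ c : k, opMul k D (algebraMap _ (RatFun k n) (algebraMap k (MvPolynomial (Fin n) k) c))
      = algebraMap k (Module.End (Z k D) (IndMod k D)) c := fun c => by
    refine LinearMap.ext fun v => funext fun w => ?_
    rw [opMul_apply, Module.algebraMap_end_apply, Pi.smul_apply, Pi.smul_apply, smul_eq_mul,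
      Algebra.smul_def, IsScalarTower.algebraMap_apply k (MvPolynomial (Fin n) k) (RatFun k n)]
  induction f using MvPolynomial.induction_on with
  | C c => rw [← MvPolynomial.algebraMap_eq, AlgHom.commutes, AlgHom.commutes, h]
  | add p q hp hq => rw [map_add, map_add, map_add, map_add, hp, hq]
  | mul_X p r hp =>
    rw [map_mul, map_mul, map_mul, map_mul, hp, polyToH_X]
    exact congrArg _ (heckeRep_mk_ι k D (HGen.x r))

/-- The action of the Hecke algebra on the induced module, as a homomorphism of `Z`-algebras. -/
noncomputable def heckeRepZ : H k D →ₐ[Z k D] Module.End (Z k D) (IndMod k D) :=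
  { (heckeRep k D : H k D →+* Module.End (Z k D) (IndMod k D)) with
    commutes' := fun z => (heckeRep_polyToH k D z).trans <|
      LinearMap.ext fun v => funext fun w => (Algebra.smul_def z (v w)).symm }

/-- The action of the rationalization `H_F` on the induced module. -/
noncomputable def ratRep : HF k D →ₐ[Z k D] Module.End (Z k D) (IndMod k D) :=
  Algebra.TensorProduct.lift (heckeRepZ k D) ((opMul k D).comp (fieldToRat k D)) fun _ c =>
    commute_opMul_fieldToRat k D _ c

theorem ratRep_t (r : Fin n) : ratRep k D (HF.t k D r) = opT k D r := by
  refine (Algebra.TensorProduct.lift_tmul _ _ _ _ _).trans ?_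
  rw [map_one, mul_one]
  exact heckeRep_t k D r

theorem ratRep_ratToHF (f : RatFun k n) : ratRep k D (ratToHF k D f) = opMul k D f := by
  refine RingHom.congr_fun (f := (ratRep k D).toRingHom.comp (ratToHF k D))
    (g := (opMul k D).toRingHom) (ratFun_ringHom_ext fun p => ?_) f
  change ratRep k D (ratToHF k D (algebraMap _ _ p)) = opMul k D (algebraMap _ _ p)
  rw [ratToHF_algebraMap]
  refine (Algebra.TensorProduct.lift_tmul _ _ _ _ _).trans ?_
  rw [map_one, mul_one]
  exact heckeRep_polyToH k D p

end Representation

/-! ### Systems of intertwining elements -/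

section Systems

variable {k : Type*} [Field k] {n : ℕ} {D : DynkinDiagram n} {B : Type*} [Ring B]

/-- A relation `b p = σ(p) b` for polynomials `p` extends to rational functions. -/
theorem mul_map_of_mul_map_poly {ι : RatFun k n →+* B} {b : B} {σ : RatFun k n ≃+* RatFun k n}
    (h : ∀ p : MvPolynomial (Fin n) k, b * ι (algebraMap _ _ p) = ι (σ (algebraMap _ _ p)) * b)
    (f : RatFun k n) : b * ι f = ι (σ f) * b := by
  obtain ⟨p, q, hq, rfl⟩ := IsFractionRing.div_surjective (A := MvPolynomial (Fin n) k) f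
  have hq0 : algebraMap (MvPolynomial (Fin n) k) (RatFun k n) q ≠ 0 :=
    IsFractionRing.to_map_ne_zero_of_mem_nonZeroDivisors hq
  set P := algebraMap (MvPolynomial (Fin n) k) (RatFun k n) p with hP
  set Q := algebraMap (MvPolynomial (Fin n) k) (RatFun k n) q with hQ
  have hσ : σ Q ≠ 0 := (map_ne_zero σ).mpr hq0
  calc b * ι (P / Q) = ι ((σ Q)⁻¹) * (ι (σ Q) * b) * ι (P / Q) := by
        rw [← mul_assoc, ← map_mul, inv_mul_cancel₀ hσ, map_one, one_mul]
    _ = ι ((σ Q)⁻¹) * (b * ι P) := by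
        rw [← h q, mul_assoc, mul_assoc, ← map_mul, mul_div_cancel₀ P hq0]
    _ = ι (σ (P / Q)) * b := by
        rw [h p, ← mul_assoc, ← map_mul, map_div₀, div_eq_inv_mul]

/-- The relations that the intertwining elements `φ_r` satisfy with each other and with the
rational functions, in a ring `B` that receives `k(x)`. -/
structure IsIntertwinerSystem (D : DynkinDiagram n) (ι : RatFun k n →+* B) (φ : Fin n → B) :
    Prop where
  braided : IsBraided D φ
  mul_rat : ∀ r f, φ r * ι f = ι (ratRefl k D r f) * φ r
  mul_self : ∀ r, φ r * φ r = ι (1 - (ratX k r)⁻¹ ^ 2)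

/-- The map that sends a family of coefficients `c_w` to `∑_w c_w g_w`. -/
noncomputable def expand (ι : RatFun k n →+* B) (g : D.W → B) : (D.W →₀ RatFun k n) →+ B :=
  Finsupp.liftAddHom fun w => (AddMonoidHom.mulRight (g w)).comp ι.toAddMonoidHom

theorem expand_single (ι : RatFun k n →+* B) (g : D.W → B) (w : D.W) (f : RatFun k n) :
    expand ι g (Finsupp.single w f) = ι f * g w :=
  Finsupp.liftAddHom_apply_single _ _ _

/-- The elements that preserve an additive subgroup under left multiplication. -/
def leftIdealizer (S : AddSubgroup B) : Subring B where
  carrier := {b | ∀ y ∈ S, b * y ∈ S}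
  mul_mem' ha hb y hy := by
    rw [mul_assoc]
    exact ha _ (hb y hy)
  one_mem' y hy := by rwa [one_mul]
  add_mem' ha hb y hy := by
    rw [add_mul]
    exact S.add_mem (ha y hy) (hb y hy)
  zero_mem' y _ := by
    rw [zero_mul]
    exact S.zero_mem
  neg_mem' ha y hy := by
    rw [neg_mul]
    exact S.neg_mem (ha y hy)

theorem rat_mem_leftIdealizer (ι : RatFun k n →+* B) (g : D.W → B) (f : RatFun k n) :
    ι f ∈ leftIdealizer (expand ι g).range := by
  rintro _ ⟨c, rfl⟩
  induction c using Finsupp.induction_linear with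
  | zero => simp
  | add c c' hc hc' =>
    rw [map_add, mul_add]
    exact AddSubgroup.add_mem _ hc hc'
  | single w f' =>
    exact ⟨Finsupp.single w (f * f'), by simp only [expand_single, map_mul, mul_assoc]⟩

theorem simple_mem_leftIdealizer {ι : RatFun k n →+* B} {g : D.W →* B} {r : Fin n}
    (h : ∀ f, ∃ f₁ f₂, g (D.cs.simple r) * ι f = ι f₁ * g (D.cs.simple r) + ι f₂) :
    g (D.cs.simple r) ∈ leftIdealizer (expand ι g).range := by
  rintro _ ⟨c, rfl⟩
  induction c using Finsupp.induction_linear with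
  | zero => simp
  | add c c' hc hc' =>
    rw [map_add, mul_add]
    exact AddSubgroup.add_mem _ hc hc'
  | single w f =>
    obtain ⟨f₁, f₂, hf⟩ := h f
    refine ⟨Finsupp.single (D.cs.simple r * w) f₁ + Finsupp.single w f₂, ?_⟩
    rw [map_add, expand_single, expand_single, expand_single, ← mul_assoc, hf, add_mul, map_mul,
      mul_assoc]

theorem expand_surjective_of_leftIdealizer {ι : RatFun k n →+* B} {g : D.W →* B}
    (h : leftIdealizer (expand ι g).range = ⊤) : Function.Surjective (expand ι g) := fun b => by
  have hb : b ∈ leftIdealizer (expand ι g).range := h ▸ Subring.mem_top b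
  have := hb 1 ⟨Finsupp.single 1 1, by rw [expand_single, map_one, map_one, mul_one]⟩
  rwa [mul_one] at this

theorem one_add_inv_ratX_ne_zero (r : Fin n) : 1 + (ratX k r)⁻¹ ≠ 0 := by
  have h : 1 + (ratX k r)⁻¹ = (1 + ratX k r) * (ratX k r)⁻¹ := by
    rw [add_mul, one_mul, mul_inv_cancel₀ (ratX_ne_zero k r), add_comm]
  rw [h]
  exact mul_ne_zero (one_add_ratX_ne_zero k r) (inv_ne_zero (ratX_ne_zero k r))

variable (k D) in
/-- The factor by which a product of intertwining elements `φ_r` differs from the corresponding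
product of the normalized elements `(1 + x_r⁻¹)⁻¹ φ_r`. -/
noncomputable def normFactor : List (Fin n) → RatFun k n
  | [] => 1
  | r :: ω => (1 + (ratX k r)⁻¹) * ratRefl k D r (normFactor ω)

theorem normFactor_ne_zero (ω : List (Fin n)) : normFactor k D ω ≠ 0 := by
  induction ω with
  | nil => exact one_ne_zero
  | cons r ω hω => exact mul_ne_zero (one_add_inv_ratX_ne_zero r) ((map_ne_zero _).mpr hω)

namespace IsIntertwinerSystem

variable {ι : RatFun k n →+* B} {φ : Fin n → B}

theorem isLiftable (h : IsIntertwinerSystem D ι φ) :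
    D.coxeterMatrix.IsLiftable fun r => ι (1 + (ratX k r)⁻¹)⁻¹ * φ r := by
  refine (h.braided.twist h.mul_rat (fun f => (1 + f⁻¹)⁻¹) fun r f => ?_).isLiftable fun r => ?_
  · simp only [map_inv₀, map_add, map_one]
  · have h0 := one_add_inv_ratX_ne_zero (k := k) r
    have h1 : ratRefl k D r (1 + (ratX k r)⁻¹) ≠ 0 := (map_ne_zero _).mpr h0
    have h2 : 1 - (ratX k r)⁻¹ ^ 2 = (1 + (ratX k r)⁻¹) * ratRefl k D r (1 + (ratX k r)⁻¹) := by
      rw [map_add, map_one, map_inv₀, ratRefl_ratX_self, inv_neg]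
      ring
    rw [mul_assoc, ← mul_assoc (φ r), h.mul_rat, mul_assoc, h.mul_self, ← map_mul, ← map_mul, h2,
      map_inv₀, mul_left_comm _ (1 + _), inv_mul_cancel₀ h1, mul_one, inv_mul_cancel₀ h0, map_one]

/-- The copy of the Weyl group that is generated by the normalized intertwining elements
`(1 + x_r⁻¹)⁻¹ φ_r`. -/
noncomputable def weylHom (h : IsIntertwinerSystem D ι φ) : D.W →* B :=
  D.cs.lift ⟨_, h.isLiftable⟩

theorem weylHom_simple (h : IsIntertwinerSystem D ι φ) (r : Fin n) :
    h.weylHom (D.cs.simple r) = ι (1 + (ratX k r)⁻¹)⁻¹ * φ r :=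
  D.cs.lift_apply_simple h.isLiftable r

theorem eq_mul_weylHom (h : IsIntertwinerSystem D ι φ) (r : Fin n) :
    φ r = ι (1 + (ratX k r)⁻¹) * h.weylHom (D.cs.simple r) := by
  rw [weylHom_simple, ← mul_assoc, ← map_mul, mul_inv_cancel₀ (one_add_inv_ratX_ne_zero r),
    map_one, one_mul]

theorem weylHom_mul_rat (h : IsIntertwinerSystem D ι φ) (w : D.W) (f : RatFun k n) :
    h.weylHom w * ι f = ι (ratAct k D w f) * h.weylHom w := by
  induction w using D.cs.simple_induction_left with
  | one => rw [map_one, ratAct_one, one_mul, mul_one]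
  | mul_simple_left w r hw =>
    rw [map_mul, mul_assoc, hw, ← mul_assoc, weylHom_simple, mul_assoc _ (φ r), h.mul_rat,
      ratAct_mul, ← mul_assoc, ← map_mul, mul_comm _ (ratRefl k D r _), map_mul, mul_assoc,
      mul_assoc, mul_assoc]

theorem mem_leftIdealizer (h : IsIntertwinerSystem D ι φ) (r : Fin n) :
    φ r ∈ leftIdealizer (expand ι h.weylHom).range := by
  rw [h.eq_mul_weylHom r]
  refine mul_mem (rat_mem_leftIdealizer _ _ _) (simple_mem_leftIdealizer fun f => ?_)
  exact ⟨ratRefl k D r f, 0, by rw [weylHom_mul_rat, map_zero, add_zero]⟩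

theorem prod_map_eq (h : IsIntertwinerSystem D ι φ) (ω : List (Fin n)) :
    (ω.map φ).prod = ι (normFactor k D ω) * h.weylHom (D.cs.wordProd ω) := by
  induction ω with
  | nil => simp [normFactor]
  | cons r ω hω =>
    rw [List.map_cons, List.prod_cons, hω, D.cs.wordProd_cons, map_mul, normFactor, map_mul,
      ← mul_assoc, h.mul_rat, h.eq_mul_weylHom r, mul_assoc, mul_assoc, ← mul_assoc _ (ι _), ←
      map_mul, ← map_mul, mul_comm (ratRefl k D r _), map_mul]

/-- The span over the rational functions of the normalized elements of length less than `m`. -/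
def lengthFiltration (h : IsIntertwinerSystem D ι φ) (m : ℕ) : AddSubgroup B :=
  AddSubgroup.closure {y | ∃ f w, D.cs.length w < m ∧ y = ι f * h.weylHom w}

theorem rat_mul_mem_lengthFiltration (h : IsIntertwinerSystem D ι φ) {m : ℕ} (f : RatFun k n)
    {y : B} (hy : y ∈ h.lengthFiltration m) : ι f * y ∈ h.lengthFiltration m := by
  induction hy using AddSubgroup.closure_induction with
  | mem y hy =>
    obtain ⟨f', w, hw, rfl⟩ := hy
    exact AddSubgroup.subset_closure ⟨f * f', w, hw, by rw [map_mul, mul_assoc]⟩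
  | zero => rw [mul_zero]; exact zero_mem _
  | add y y' _ _ hy hy' => rw [mul_add]; exact add_mem hy hy'
  | neg y _ hy => rw [mul_neg]; exact neg_mem hy

theorem mul_mem_lengthFiltration (h : IsIntertwinerSystem D ι φ) {m : ℕ} (r : Fin n)
    {y : B} (hy : y ∈ h.lengthFiltration m) : φ r * y ∈ h.lengthFiltration (m + 1) := by
  induction hy using AddSubgroup.closure_induction with
  | mem y hy =>
    obtain ⟨f, w, hw, rfl⟩ := hy
    refine AddSubgroup.subset_closure ⟨ratRefl k D r f * (1 + (ratX k r)⁻¹), D.cs.simple r * w,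
      ?_, ?_⟩
    · have := D.cs.length_simple_mul w r
      omega
    · rw [← mul_assoc, h.mul_rat, mul_assoc]
      nth_rewrite 1 [h.eq_mul_weylHom r]
      simp only [map_mul, mul_assoc]
  | zero => rw [mul_zero]; exact zero_mem _
  | add y y' _ _ hy hy' => rw [mul_add]; exact add_mem hy hy'
  | neg y _ hy => rw [mul_neg]; exact neg_mem hy

theorem lengthFiltration_mono (h : IsIntertwinerSystem D ι φ) {m m' : ℕ} (hm : m ≤ m') :
    h.lengthFiltration m ≤ h.lengthFiltration m' :=
  AddSubgroup.closure_mono fun _ ⟨f, w, hw, hy⟩ => ⟨f, w, hw.trans_le hm, hy⟩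

theorem exists_expand_of_mem_lengthFiltration (h : IsIntertwinerSystem D ι φ) {m : ℕ} {y : B}
    (hy : y ∈ h.lengthFiltration m) :
    ∃ c, expand ι h.weylHom c = y ∧ ∀ w, m ≤ D.cs.length w → c w = 0 := by
  induction hy using AddSubgroup.closure_induction with
  | mem y hy =>
    obtain ⟨f, w, hw, rfl⟩ := hy
    refine ⟨Finsupp.single w f, expand_single _ _ _ _, fun v hv => ?_⟩
    rw [Finsupp.single_eq_of_ne]
    rintro rfl
    omega
  | zero => exact ⟨0, map_zero _, fun _ _ => rfl⟩
  | add y y' _ _ hy hy' =>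
    obtain ⟨c, rfl, hc⟩ := hy
    obtain ⟨c', rfl, hc'⟩ := hy'
    exact ⟨c + c', map_add _ _ _, fun w hw => by
      rw [Finsupp.add_apply, hc w hw, hc' w hw, add_zero]⟩
  | neg y _ hy =>
    obtain ⟨c, rfl, hc⟩ := hy
    exact ⟨-c, map_neg _ _, fun w hw => by rw [Finsupp.neg_apply, hc w hw, neg_zero]⟩

/-- A product of the elements `t_r = φ_r - x_r⁻¹` has the same leading term, with respect to the
length, as the product of the `φ_r`. -/
theorem prod_sub_prod_mem_lengthFiltration (h : IsIntertwinerSystem D ι φ) (ω : List (Fin n)) :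
    (ω.map fun r => φ r - ι (ratX k r)⁻¹).prod ∈ h.lengthFiltration (ω.length + 1) ∧
      (ω.map φ).prod - (ω.map fun r => φ r - ι (ratX k r)⁻¹).prod ∈
        h.lengthFiltration ω.length := by
  induction ω with
  | nil =>
    refine ⟨AddSubgroup.subset_closure ⟨1, 1, ?_, ?_⟩, ?_⟩
    · rw [D.cs.length_one]
      exact Nat.zero_lt_succ _
    · simp
    · rw [List.map_nil, List.map_nil, sub_self]
      exact zero_mem _
  | cons r ω hω =>
    obtain ⟨h1, h2⟩ := hω
    simp only [List.map_cons, List.prod_cons, List.length_cons]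
    set Φ := (ω.map φ).prod
    set T := (ω.map fun r => φ r - ι (ratX k r)⁻¹).prod
    constructor
    · rw [sub_mul]
      exact sub_mem (h.mul_mem_lengthFiltration r h1)
        (h.lengthFiltration_mono (Nat.le_succ _) (h.rat_mul_mem_lengthFiltration _ h1))
    · have : φ r * Φ - (φ r - ι (ratX k r)⁻¹) * T = φ r * (Φ - T) + ι (ratX k r)⁻¹ * T := by
        rw [sub_mul, mul_sub]
        abel
      rw [this]
      exact add_mem (h.mul_mem_lengthFiltration r h2) (h.rat_mul_mem_lengthFiltration _ h1)

/-- If the normalized elements are independent over the rational functions, and the elements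
`φ_r - x_r⁻¹` generate a copy of the Weyl group, then the products of the `φ_r` along two reduced
expressions of the same element agree. -/
theorem prod_map_eq_of_isReduced (h : IsIntertwinerSystem D ι φ)
    (hinj : Function.Injective (expand ι h.weylHom)) {t : D.W →* B}
    (ht : ∀ r, t (D.cs.simple r) = φ r - ι (ratX k r)⁻¹) {ω ω' : List (Fin n)}
    (hω : D.cs.IsReduced ω) (hω' : D.cs.IsReduced ω')
    (hw : D.cs.wordProd ω = D.cs.wordProd ω') : (ω.map φ).prod = (ω'.map φ).prod := by
  have hT : ∀ ω : List (Fin n), (ω.map fun r => φ r - ι (ratX k r)⁻¹).prod =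
      t (D.cs.wordProd ω) := fun ω => by
    simp only [← ht, CoxeterSystem.wordProd, map_list_prod, List.map_map, Function.comp_def]
  have hl : ω'.length = ω.length := by rw [← hω'.eq, ← hω.eq, hw]
  have h1 := (h.prod_sub_prod_mem_lengthFiltration ω).2
  have h2 := (h.prod_sub_prod_mem_lengthFiltration ω').2
  rw [hT, hl, ← hw] at h2
  rw [hT] at h1
  have h3 := sub_mem h1 h2
  rw [sub_sub_sub_cancel_right, h.prod_map_eq, h.prod_map_eq, ← hw, ← sub_mul, ← map_sub] at h3
  obtain ⟨c, hc, hc0⟩ := h.exists_expand_of_mem_lengthFiltration h3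
  rw [← expand_single ι h.weylHom] at hc
  have h4 := hc0 (D.cs.wordProd ω) hω.eq.ge
  rw [hinj hc, Finsupp.single_eq_same, sub_eq_zero] at h4
  rw [h.prod_map_eq, h.prod_map_eq, h4, hw]

end IsIntertwinerSystem

end Systems

/-! ### Bases of the rationalization -/

section Rationalization

variable (k : Type*) [Field k] {n : ℕ} (D : DynkinDiagram n)

theorem isBraided_HF_t : IsBraided D (HF.t k D) := by
  have h : IsBraided D (H.t k D) :=
    { comm := fun r s h => by
        simpa only [H.t, map_mul] using H.mk_rel k D (HRel.braid2 (k := k) r s h)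
      single := fun r s h h' => by
        simpa only [H.t, map_mul] using H.mk_rel k D (HRel.braid3 (k := k) r s h h')
      double := fun r s h => by
        simpa only [H.t, map_mul, map_pow] using H.mk_rel k D (HRel.braid4 (k := k) r s h)
      triple := fun r s h => by
        simpa only [H.t, map_mul, map_pow] using H.mk_rel k D (HRel.braid6 (k := k) r s h) }
  exact h.map ((Algebra.TensorProduct.includeLeft : H k D →ₐ[Z k D] HF k D) : H k D →* HF k D)

theorem HF.t_mul_self (r : Fin n) : HF.t k D r * HF.t k D r = 1 := by
  have h : H.t k D r * H.t k D r = 1 := by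
    have := H.mk_rel k D (HRel.tt (k := k) (D := D) r)
    rwa [map_pow, map_one, pow_two] at this
  change (H.t k D r ⊗ₜ[Z k D] (1 : F k D)) * (H.t k D r ⊗ₜ[Z k D] (1 : F k D)) = 1
  rw [Algebra.TensorProduct.tmul_mul_tmul, h, one_mul, Algebra.TensorProduct.one_def]

/-- The copy of the Weyl group in `H_F` that is generated by the `t_r`. -/
noncomputable def weylHF : D.W →* HF k D :=
  D.cs.lift ⟨HF.t k D, (isBraided_HF_t k D).isLiftable (HF.t_mul_self k D)⟩

theorem weylHF_simple (r : Fin n) : weylHF k D (D.cs.simple r) = HF.t k D r :=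
  D.cs.lift_apply_simple _ r

variable [Finite D.W]

theorem HF.phi_eq (r : Fin n) : HF.phi k D r = HF.t k D r + ratToHF k D (ratX k r)⁻¹ := rfl

theorem HF.phi_mul_rat (r : Fin n) (f : RatFun k n) :
    HF.phi k D r * ratToHF k D f = ratToHF k D (ratRefl k D r f) * HF.phi k D r := by
  refine mul_map_of_mul_map_poly (σ := ratRefl k D r) (fun p => ?_) f
  obtain ⟨g, h1, h2⟩ := t_mul_poly k D r p
  have h3 : HF.t k D r * ratToHF k D (algebraMap _ _ p) =
      ratToHF k D (ratRefl k D r (algebraMap _ _ p)) * HF.t k D r +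
        ratToHF k D (algebraMap _ _ g) := by
    rw [ratRefl_algebraMap, ratToHF_algebraMap, ratToHF_algebraMap, ratToHF_algebraMap]
    change (H.t k D r ⊗ₜ[Z k D] (1 : F k D)) * _ = _ * (H.t k D r ⊗ₜ[Z k D] (1 : F k D)) + _
    rw [Algebra.TensorProduct.tmul_mul_tmul, Algebra.TensorProduct.tmul_mul_tmul, h2, mul_one,
      TensorProduct.add_tmul]
  have h4 : algebraMap _ (RatFun k n) g =
      (ratX k r)⁻¹ * (ratRefl k D r (algebraMap _ _ p) - algebraMap _ _ p) := by
    rw [ratRefl_algebraMap, ← map_sub, ← h1, map_mul, inv_mul_cancel_left₀ (ratX_ne_zero k r)]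
  rw [HF.phi_eq, add_mul, h3, mul_add, ← map_mul, ← map_mul, add_assoc,
    ← map_add, h4]
  congr 2
  ring

theorem HF.phi_mul_self (r : Fin n) :
    HF.phi k D r * HF.phi k D r = ratToHF k D (1 - (ratX k r)⁻¹ ^ 2) := by
  have h : HF.phi k D r * ratToHF k D (ratX k r)⁻¹ =
      -(ratToHF k D (ratX k r)⁻¹ * HF.phi k D r) := by
    rw [HF.phi_mul_rat, map_inv₀, ratRefl_ratX_self, inv_neg, map_neg, neg_mul]
  nth_rewrite 2 [HF.phi_eq]
  rw [mul_add, h, HF.phi_eq, add_mul, HF.t_mul_self, mul_add, map_sub, map_one, map_pow, pow_two]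
  abel

variable {k D} in
/-- The rational functions and the `t_r` generate `H_F` as a ring. -/
theorem HF.subring_eq_top {S : Subring (HF k D)} (hf : ∀ f, ratToHF k D f ∈ S)
    (ht : ∀ r, HF.t k D r ∈ S) : S = ⊤ := by
  have h : ∀ y, (H.mk k D y ⊗ₜ[Z k D] (1 : F k D) : HF k D) ∈ S := by
    intro y
    induction y using FreeAlgebra.induction with
    | grade0 c =>
      have := hf (algebraMap _ _ (algebraMap k (MvPolynomial (Fin n) k) c))
      rw [ratToHF_algebraMap, AlgHom.commutes] at this
      rwa [AlgHom.commutes]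
    | grade1 g =>
      cases g with
      | x r =>
        have := hf (ratX k r)
        rwa [ratToHF_algebraMap, polyToH_X] at this
      | t r => exact ht r
    | mul a b ha hb =>
      have := mul_mem ha hb
      rwa [Algebra.TensorProduct.tmul_mul_tmul, mul_one, ← map_mul] at this
    | add a b ha hb =>
      rw [map_add, TensorProduct.add_tmul]
      exact add_mem ha hb
  refine eq_top_iff.mpr fun y _ => ?_
  induction y using TensorProduct.induction_on with
  | zero => exact zero_mem S
  | add y y' hy hy' => exact add_mem (hy trivial) (hy' trivial)
  | tmul b c =>
    obtain ⟨b, rfl⟩ := H.mk_surjective k D b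
    have := mul_mem (h b) (hf (fieldToRat k D c))
    rwa [ratToHF_fieldToRat, Algebra.TensorProduct.tmul_mul_tmul, mul_one, one_mul] at this

theorem expand_weylHF_surjective :
    Function.Surjective (expand (ratToHF k D) (weylHF k D)) := by
  refine expand_surjective_of_leftIdealizer
    (HF.subring_eq_top (rat_mem_leftIdealizer _ _) fun r => ?_)
  rw [← weylHF_simple]
  refine simple_mem_leftIdealizer fun f =>
    ⟨ratRefl k D r f, ratRefl k D r f * (ratX k r)⁻¹ - f * (ratX k r)⁻¹, ?_⟩
  rw [weylHF_simple, map_sub, map_mul _ f, map_mul, ← add_sub_assoc, ← mul_add, ← HF.phi_eq,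
    ← HF.phi_mul_rat, HF.phi_eq, add_mul, ← map_mul, ← map_mul, mul_comm f, add_sub_cancel_right]

/-- The vector `1 ⊗ 1` of the induced module. -/
noncomputable def indVec : IndMod k D :=
  haveI := Classical.decEq D.W
  Pi.single 1 1

theorem ratRep_weylHF_indVec [DecidableEq D.W] (w : D.W) :
    ratRep k D (weylHF k D w) (indVec k D) = Pi.single w 1 := by
  induction w using D.cs.simple_induction_left with
  | one =>
    rw [map_one, map_one, Module.End.one_apply]
    unfold indVec
    congr!
  | mul_simple_left w r hw =>
    rw [map_mul, map_mul, Module.End.mul_apply, hw, weylHF_simple, ratRep_t, opT_single]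

theorem ratRep_expand (g : D.W → HF k D) (c : D.W →₀ RatFun k n) (v : IndMod k D) :
    ratRep k D (expand (ratToHF k D) g c) v =
      Finsupp.linearCombination (RatFun k n) (fun w => ratRep k D (g w) v) c := by
  induction c using Finsupp.induction_linear with
  | zero => simp
  | add c c' hc hc' =>
    rw [map_add, map_add, LinearMap.add_apply, hc, hc', map_add]
  | single w f =>
    rw [expand_single, map_mul, ratRep_ratToHF, Finsupp.linearCombination_single]
    rfl

/-- The induced module is a regular module of `H_F`: the coefficients of an element with respect to
the `t_w` are the coordinates of its action on `1 ⊗ 1`. -/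
theorem ratRep_expand_weylHF (c : D.W →₀ RatFun k n) :
    ratRep k D (expand (ratToHF k D) (weylHF k D) c) (indVec k D) = c := by
  classical
  rw [ratRep_expand]
  simp only [ratRep_weylHF_indVec]
  induction c using Finsupp.induction_linear with
  | zero => simp
  | add c c' hc hc' =>
    rw [map_add, hc, hc', Finsupp.coe_add]
  | single w f =>
    rw [Finsupp.linearCombination_single, Finsupp.single_eq_pi_single, ← Pi.single_smul,
      smul_eq_mul, mul_one]

theorem ratRep_injective : Function.Injective (ratRep k D) := by
  refine (injective_iff_map_eq_zero _).mpr fun y hy => ?_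
  obtain ⟨c, rfl⟩ := expand_weylHF_surjective k D y
  have := ratRep_expand_weylHF k D c
  rw [hy, LinearMap.zero_apply] at this
  have hc : c = 0 := DFunLike.coe_injective this.symm
  rw [hc, map_zero]

theorem isIntertwinerSystem_phi : IsIntertwinerSystem D (ratToHF k D) (HF.phi k D) where
  braided := by
    refine IsBraided.of_map (f := (ratRep k D : HF k D →* Module.End (Z k D) (IndMod k D)))
      (ratRep_injective k D) ?_
    have h : (fun r => ratRep k D (HF.phi k D r)) = fun r => opT k D r + opMul k D (ratX k r)⁻¹ :=
      funext fun r => by rw [HF.phi_eq, map_add, ratRep_t, ratRep_ratToHF]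
    exact h ▸ isBraided_opPhi
  mul_rat := HF.phi_mul_rat k D
  mul_self := HF.phi_mul_self k D

theorem leftIdealizer_weylHom_eq_top :
    leftIdealizer (expand (ratToHF k D) (isIntertwinerSystem_phi k D).weylHom).range = ⊤ := by
  refine HF.subring_eq_top (rat_mem_leftIdealizer _ _) fun r => ?_
  have := sub_mem ((isIntertwinerSystem_phi k D).mem_leftIdealizer r)
    (rat_mem_leftIdealizer (ratToHF k D) (isIntertwinerSystem_phi k D).weylHom (ratX k r)⁻¹)
  rwa [HF.phi_eq, add_sub_cancel_right] at this

/-- The normalized elements are a basis: they span `H_F`, and there are as many of them as of the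
basis elements `t_w`. -/
theorem expand_weylHom_bijective :
    Function.Bijective (expand (ratToHF k D) (isIntertwinerSystem_phi k D).weylHom) := by
  set g := (isIntertwinerSystem_phi k D).weylHom with hg
  have hsurj : Function.Surjective (expand (ratToHF k D) g) :=
    expand_surjective_of_leftIdealizer (leftIdealizer_weylHom_eq_top k D)
  refine ⟨?_, hsurj⟩
  have hL : ∀ c, Finsupp.linearCombination (RatFun k n) (fun w => ratRep k D (g w) (indVec k D)) c =
      ratRep k D (expand (ratToHF k D) g c) (indVec k D) := fun c =>
    (ratRep_expand k D g c _).symm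
  have hLsurj : Function.Surjective
      (Finsupp.linearCombination (RatFun k n) fun w => ratRep k D (g w) (indVec k D)) := fun v => by
    obtain ⟨c, hc⟩ := hsurj (expand (ratToHF k D) (weylHF k D) (Finsupp.equivFunOnFinite.symm v))
    refine ⟨c, ?_⟩
    rw [hL, hc, ratRep_expand_weylHF]
    rfl
  have hLinj := (LinearMap.injective_iff_surjective_of_finrank_eq_finrank (by
    exact (Finsupp.linearEquivFunOnFinite (RatFun k n) (RatFun k n) D.W).finrank_eq)).mpr hLsurj
  intro c c' h
  exact hLinj (by rw [hL, hL, h])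

end Rationalization

/-! ### The presentation by intertwining elements -/

section Presentation

/-- A homomorphism from the polynomial ring to a ring, which need not be commutative, extends to
the rational functions if it makes the nonzero polynomials invertible. -/
theorem exists_ratFun_ringHom {k : Type*} [Field k] {n : ℕ} {B : Type*} [Ring B]
    (p : MvPolynomial (Fin n) k →+* B) (hp : ∀ f, f ≠ 0 → IsUnit (p f)) :
    ∃ ι : RatFun k n →+* B, ∀ f, ι (algebraMap _ _ f) = p f := by
  let u : nonZeroDivisors (MvPolynomial (Fin n) k) →* Bˣ :=
    IsUnit.liftRight (p.toMonoidHom.comp (nonZeroDivisors (MvPolynomial (Fin n) k)).subtype)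
      fun s => hp s (nonZeroDivisors.ne_zero s.2)
  exact ⟨OreLocalization.universalHom p u fun _ => rfl,
    fun f => OreLocalization.universalHom_commutes p u fun _ => rfl⟩

variable {k : Type*} [Field k] {n : ℕ}

theorem map_gpoly {B : Type*} [Ring B] [Algebra k B] {ψ : FreeAlgebra k (IGen k n) →ₐ[k] B}
    {p : MvPolynomial (Fin n) k →ₐ[k] B} (h : ∀ r, ψ (gx k r) = p (MvPolynomial.X r))
    (f : MvPolynomial (Fin n) k) : ψ (gpoly k f) = p f := by
  conv_rhs => rw [f.as_sum]
  rw [gpoly, map_sum, map_sum]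
  refine Finset.sum_congr rfl fun m _ => ?_
  have hm : MvPolynomial.monomial m (f.coeff m) =
      f.coeff m • (List.ofFn fun r => (MvPolynomial.X r : MvPolynomial (Fin n) k) ^ m r).prod := by
    rw [List.prod_ofFn, MvPolynomial.monomial_eq, MvPolynomial.C_mul',
      Finsupp.prod_fintype _ _ fun r => pow_zero _]
  rw [hm, map_smul, map_smul, map_list_prod, map_list_prod, List.map_ofFn, List.map_ofFn]
  simp only [Function.comp_def, map_pow, h]

variable (k) (D : DynkinDiagram n)

theorem Presented.mk_rel {a b : FreeAlgebra k (IGen k n)} (h : IRel k D a b) :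
    Presented.mk k D a = Presented.mk k D b :=
  RingQuot.mkAlgHom_rel k h

theorem Presented.mk_surjective : Function.Surjective (Presented.mk k D) :=
  RingQuot.mkAlgHom_surjective k (IRel k D)

theorem Presented.x_comm : ∀ p ∈ Set.range fun r => Presented.gen k D (IGen.x r),
    ∀ q ∈ Set.range fun r => Presented.gen k D (IGen.x r), p * q = q * p := by
  rintro _ ⟨r, rfl⟩ _ ⟨s, rfl⟩
  simpa only [Presented.gen, map_mul] using Presented.mk_rel k D (IRel.xx r s)

open scoped IsMulCommutative in
/-- The homomorphism from the polynomial ring to the presented algebra. -/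
noncomputable def polyToPresented : MvPolynomial (Fin n) k →ₐ[k] Presented k D :=
  haveI := Algebra.isMulCommutative_adjoin k (Presented.x_comm k D)
  (Algebra.adjoin k (Set.range fun r => Presented.gen k D (IGen.x r))).val.comp
    (MvPolynomial.aeval fun r =>
      (⟨Presented.gen k D (IGen.x r), Algebra.subset_adjoin ⟨r, rfl⟩⟩ :
        Algebra.adjoin k (Set.range fun r => Presented.gen k D (IGen.x r))))

theorem polyToPresented_X (r : Fin n) :
    polyToPresented k D (MvPolynomial.X r) = Presented.gen k D (IGen.x r) := by
  simp [polyToPresented]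

theorem mk_gpoly (f : MvPolynomial (Fin n) k) :
    Presented.mk k D (gpoly k f) = polyToPresented k D f :=
  map_gpoly (fun r => (polyToPresented_X k D r).symm) f

theorem poly_mul_inv {f : MvPolynomial (Fin n) k} (hf : f ≠ 0) :
    polyToPresented k D f * Presented.gen k D (IGen.inv f hf) = 1 := by
  have := Presented.mk_rel k D (IRel.mul_inv f hf)
  rwa [map_mul, map_one, mk_gpoly] at this

theorem inv_mul_poly {f : MvPolynomial (Fin n) k} (hf : f ≠ 0) :
    Presented.gen k D (IGen.inv f hf) * polyToPresented k D f = 1 := by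
  have := Presented.mk_rel k D (IRel.inv_mul f hf)
  rwa [map_mul, map_one, mk_gpoly] at this

theorem exists_ratToPresented : ∃ ι : RatFun k n →+* Presented k D,
    ∀ f, ι (algebraMap _ _ f) = polyToPresented k D f :=
  exists_ratFun_ringHom (polyToPresented k D : MvPolynomial (Fin n) k →+* Presented k D)
    fun _ hf => ⟨⟨_, _, poly_mul_inv k D hf, inv_mul_poly k D hf⟩, rfl⟩

/-- The homomorphism from the rational functions to the presented algebra. -/
noncomputable def ratToPresented : RatFun k n →+* Presented k D :=
  (exists_ratToPresented k D).choose

theorem ratToPresented_algebraMap (f : MvPolynomial (Fin n) k) :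
    ratToPresented k D (algebraMap _ _ f) = polyToPresented k D f :=
  (exists_ratToPresented k D).choose_spec f

theorem ratToPresented_inv {f : MvPolynomial (Fin n) k} (hf : f ≠ 0) :
    ratToPresented k D (algebraMap _ _ f)⁻¹ = Presented.gen k D (IGen.inv f hf) := by
  have hf0 : algebraMap (MvPolynomial (Fin n) k) (RatFun k n) f ≠ 0 :=
    (map_ne_zero_iff _ (IsFractionRing.injective (MvPolynomial (Fin n) k) (RatFun k n))).mpr hf
  refine left_inv_eq_right_inv (a := ratToPresented k D (algebraMap _ _ f)) ?_ ?_
  · rw [← map_mul, inv_mul_cancel₀ hf0, map_one]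
  · rw [ratToPresented_algebraMap, poly_mul_inv]

theorem Presented.phi_mul_rat (r : Fin n) (f : RatFun k n) :
    Presented.gen k D (IGen.phi r) * ratToPresented k D f =
      ratToPresented k D (ratRefl k D r f) * Presented.gen k D (IGen.phi r) := by
  refine mul_map_of_mul_map_poly (σ := ratRefl k D r) (fun p => ?_) f
  rw [ratRefl_algebraMap, ratToPresented_algebraMap, ratToPresented_algebraMap]
  induction p using MvPolynomial.induction_on with
  | C c =>
    rw [← MvPolynomial.algebraMap_eq, AlgEquiv.commutes, AlgHom.commutes]
    exact (Algebra.commutes c _).symm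
  | add p q hp hq => rw [map_add, map_add, map_add, mul_add, add_mul, hp, hq]
  | mul_X p s hp =>
    have h := Presented.mk_rel k D (IRel.phix r s)
    simp only [map_mul, map_sub, map_intCast] at h
    change Presented.gen k D (IGen.phi r) * Presented.gen k D (IGen.x s) =
      (Presented.gen k D (IGen.x s) - _ * Presented.gen k D (IGen.x r)) *
        Presented.gen k D (IGen.phi r) at h
    rw [map_mul, map_mul, map_mul, ← mul_assoc, hp, mul_assoc, mul_assoc, reflEquiv_X, map_sub,
      map_mul, map_intCast, polyToPresented_X, polyToPresented_X, h]

theorem isIntertwinerSystem_presented :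
    IsIntertwinerSystem D (ratToPresented k D) fun r => Presented.gen k D (IGen.phi r) where
  braided :=
    { comm := fun r s h => by
        simpa only [Presented.gen, map_mul] using Presented.mk_rel k D (IRel.braid2 (k := k) r s h)
      single := fun r s h h' => by
        simpa only [Presented.gen, map_mul]
          using Presented.mk_rel k D (IRel.braid3 (k := k) r s h h')
      double := fun r s h => by
        simpa only [Presented.gen, map_mul, map_pow]
          using Presented.mk_rel k D (IRel.braid4 (k := k) r s h)
      triple := fun r s h => by
        simpa only [Presented.gen, map_mul, map_pow]
          using Presented.mk_rel k D (IRel.braid6 (k := k) r s h) }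
  mul_rat := Presented.phi_mul_rat k D
  mul_self r := by
    have h := Presented.mk_rel k D (IRel.phiphi r)
    simp only [map_pow, map_sub, map_one] at h
    rw [map_sub, map_one, map_pow, ratToPresented_inv, ← pow_two]
    exact h

theorem expand_presented_surjective : Function.Surjective
    (expand (ratToPresented k D) (isIntertwinerSystem_presented k D).weylHom) := by
  refine expand_surjective_of_leftIdealizer (eq_top_iff.mpr fun y _ => ?_)
  set S := leftIdealizer
    (expand (ratToPresented k D) (isIntertwinerSystem_presented k D).weylHom).range
  have hf : ∀ f, ratToPresented k D f ∈ S := rat_mem_leftIdealizer _ _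
  obtain ⟨y, rfl⟩ := Presented.mk_surjective k D y
  induction y using FreeAlgebra.induction with
  | grade0 c =>
    have := hf (algebraMap _ _ (algebraMap k (MvPolynomial (Fin n) k) c))
    rw [ratToPresented_algebraMap, AlgHom.commutes] at this
    rwa [AlgHom.commutes]
  | grade1 g =>
    cases g with
    | x r =>
      have := hf (ratX k r)
      rwa [ratToPresented_algebraMap, polyToPresented_X] at this
    | phi r => exact (isIntertwinerSystem_presented k D).mem_leftIdealizer r
    | inv f h =>
      have := hf (algebraMap _ _ f)⁻¹
      rwa [ratToPresented_inv k D h] at this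
  | mul a b ha hb =>
    rw [map_mul]
    exact mul_mem (ha trivial) (hb trivial)
  | add a b ha hb =>
    rw [map_add]
    exact add_mem (ha trivial) (hb trivial)

/-- The homomorphism from the polynomial ring to `H_F`, as a homomorphism of `k`-algebras. -/
noncomputable def polyToHF : MvPolynomial (Fin n) k →ₐ[k] HF k D :=
  (Algebra.TensorProduct.includeLeft : H k D →ₐ[k] HF k D).comp (polyToH k D)

theorem polyToHF_X (r : Fin n) : polyToHF k D (MvPolynomial.X r) = HF.x k D r :=
  congrArg (· ⊗ₜ[Z k D] (1 : F k D)) (polyToH_X k D r)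

variable [Finite D.W]

theorem polyToHF_apply (f : MvPolynomial (Fin n) k) :
    polyToHF k D f = ratToHF k D (algebraMap _ _ f) :=
  (ratToHF_algebraMap k D f).symm

/-- The images in `H_F` of the generators of the presented algebra. -/
noncomputable def genToHF : IGen k n → HF k D
  | IGen.x r => HF.x k D r
  | IGen.phi r => HF.phi k D r
  | IGen.inv f _ => HF.polyInv k D f

theorem lift_genToHF_gpoly (f : MvPolynomial (Fin n) k) :
    FreeAlgebra.lift k (genToHF k D) (gpoly k f) = ratToHF k D (algebraMap _ _ f) := by
  rw [← polyToHF_apply]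
  refine map_gpoly (fun r => ?_) f
  rw [FreeAlgebra.lift_ι_apply, polyToHF_X]
  rfl

/-- The homomorphism from the presented algebra to `H_F`. -/
noncomputable def presentedToHF : Presented k D →ₐ[k] HF k D :=
  RingQuot.liftAlgHom k ⟨FreeAlgebra.lift k (genToHF k D), fun a b h => by
    have hs := isIntertwinerSystem_phi k D
    cases h with
    | xx r s =>
      simp only [map_mul, FreeAlgebra.lift_ι_apply, genToHF, ← polyToHF_X]
      rw [← map_mul, mul_comm, map_mul]
    | mul_inv f hf =>
      rw [map_mul, map_one, lift_genToHF_gpoly, FreeAlgebra.lift_ι_apply]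
      change _ * ratToHF k D _ = 1
      rw [← map_mul, mul_inv_cancel₀, map_one]
      exact (map_ne_zero_iff _ (IsFractionRing.injective _ (RatFun k n))).mpr hf
    | inv_mul f hf =>
      rw [map_mul, map_one, lift_genToHF_gpoly, FreeAlgebra.lift_ι_apply]
      change ratToHF k D _ * _ = 1
      rw [← map_mul, inv_mul_cancel₀, map_one]
      exact (map_ne_zero_iff _ (IsFractionRing.injective _ (RatFun k n))).mpr hf
    | phix r s =>
      simp only [map_mul, map_sub, map_intCast, FreeAlgebra.lift_ι_apply, genToHF, ← polyToHF_X,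
        polyToHF_apply]
      rw [hs.mul_rat, ratRefl_ratX, map_sub, map_mul, map_intCast]
    | phiphi r =>
      simp only [map_pow, map_sub, map_one, FreeAlgebra.lift_ι_apply, genToHF]
      rw [pow_two, hs.mul_self, map_sub, map_one, map_pow]
      rfl
    | braid2 r s h =>
      simpa only [map_mul, FreeAlgebra.lift_ι_apply, genToHF] using hs.braided.comm r s h
    | braid3 r s h h' =>
      simpa only [map_mul, FreeAlgebra.lift_ι_apply, genToHF] using hs.braided.single r s h h'
    | braid4 r s h =>
      simpa only [map_mul, map_pow, FreeAlgebra.lift_ι_apply, genToHF] using hs.braided.double r s h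
    | braid6 r s h =>
      simpa only [map_mul, map_pow, FreeAlgebra.lift_ι_apply, genToHF] using hs.braided.triple r s h⟩

theorem presentedToHF_gen (g : IGen k n) :
    presentedToHF k D (Presented.gen k D g) = genToHF k D g := by
  refine (RingQuot.liftAlgHom_mkAlgHom_apply k _ _ _).trans ?_
  rw [FreeAlgebra.lift_ι_apply]

theorem presentedToHF_ratToPresented (f : RatFun k n) :
    presentedToHF k D (ratToPresented k D f) = ratToHF k D f := by
  refine RingHom.congr_fun
    (f := (presentedToHF k D : Presented k D →+* HF k D).comp (ratToPresented k D))
    (ratFun_ringHom_ext fun p => ?_) f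
  change presentedToHF k D (ratToPresented k D _) = _
  rw [ratToPresented_algebraMap, ← mk_gpoly, ← lift_genToHF_gpoly]
  exact RingQuot.liftAlgHom_mkAlgHom_apply k _ _ _

theorem presentedToHF_weylHom (w : D.W) :
    presentedToHF k D ((isIntertwinerSystem_presented k D).weylHom w) =
      (isIntertwinerSystem_phi k D).weylHom w := by
  refine DFunLike.congr_fun (f := ((presentedToHF k D : Presented k D →* HF k D)).comp
    (isIntertwinerSystem_presented k D).weylHom) (D.cs.ext_simple fun r => ?_) w
  change presentedToHF k D ((isIntertwinerSystem_presented k D).weylHom _) = _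
  rw [IsIntertwinerSystem.weylHom_simple, IsIntertwinerSystem.weylHom_simple, map_mul,
    presentedToHF_ratToPresented, presentedToHF_gen]
  rfl

/-- The homomorphism matches a spanning set of the presented algebra with a basis of `H_F`. -/
theorem presentedToHF_bijective : Function.Bijective (presentedToHF k D) := by
  have he : ∀ c, presentedToHF k D
      (expand (ratToPresented k D) (isIntertwinerSystem_presented k D).weylHom c) =
        expand (ratToHF k D) (isIntertwinerSystem_phi k D).weylHom c := fun c => by
    induction c using Finsupp.induction_linear with
    | zero => simp only [map_zero]
    | add c c' hc hc' => simp only [map_add, hc, hc']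
    | single w f => rw [expand_single, expand_single, map_mul, presentedToHF_ratToPresented,
        presentedToHF_weylHom]
  constructor
  · refine (injective_iff_map_eq_zero _).mpr fun y hy => ?_
    obtain ⟨c, rfl⟩ := expand_presented_surjective k D y
    rw [he, ← map_zero (expand (ratToHF k D) (isIntertwinerSystem_phi k D).weylHom)] at hy
    rw [(expand_weylHom_bijective k D).1 hy, map_zero]
  · intro y
    obtain ⟨c, rfl⟩ := (expand_weylHom_bijective k D).2 y
    exact ⟨_, he c⟩

end Presentation

/-- Bijectivity of a sum over finitely many coefficients is not affected by a bijective change of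
each coefficient. -/
theorem bijective_sum_comp_equiv {ι K B : Type*} [Finite ι] [Zero K] [AddCommMonoid B]
    {A : ι → K → B} (hA : ∀ i, A i 0 = 0)
    (h : Function.Bijective fun c : ι →₀ K => c.sum A) (e : ι → K ≃ K) (he : ∀ i, e i 0 = 0) :
    Function.Bijective fun c : ι →₀ K => c.sum fun i f => A i (e i f) := by
  have := Fintype.ofFinite ι
  let E : (ι →₀ K) ≃ (ι →₀ K) := Finsupp.equivFunOnFinite.trans
    ((Equiv.piCongrRight e).trans Finsupp.equivFunOnFinite.symm)
  convert h.comp E.bijective using 2 with c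
  rw [Finsupp.sum_fintype _ _ fun i => by rw [he, hA], Function.comp_apply,
    Finsupp.sum_fintype _ _ hA]
  rfl

end DegenerateAffineHecke

open DegenerateAffineHecke in
theorem proposition3 (k : Type*) [Field k] {n : ℕ} (D : DynkinDiagram n) [Finite D.W] :
    -- the presentation of `H_F`
    (∃ e : Presented k D ≃ₐ[k] HF k D,
      (∀ r, e (Presented.gen k D (IGen.x r)) = HF.x k D r) ∧
      (∀ r, e (Presented.gen k D (IGen.phi r)) = HF.phi k D r) ∧
      (∀ f hf, e (Presented.gen k D (IGen.inv f hf)) = HF.polyInv k D f)) ∧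
    -- `φ_w` does not depend on the reduced expression, and the `φ_w` form a basis of `H_F`
    -- as a left and as a right vector space over `k(x)`
    (∃ phiW : D.W → HF k D,
      (∀ ω : List (Fin n), D.cs.IsReduced ω →
        (ω.map (HF.phi k D)).prod = phiW (D.cs.wordProd ω)) ∧
      Function.Bijective (fun c : D.W →₀ RatFun k n =>
        c.sum fun w f => ratToHF k D f * phiW w) ∧
      Function.Bijective (fun c : D.W →₀ RatFun k n =>
        c.sum fun w f => phiW w * ratToHF k D f)) := by
  refine ⟨⟨AlgEquiv.ofBijective _ (presentedToHF_bijective k D),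
    fun r => presentedToHF_gen k D _, fun r => presentedToHF_gen k D _,
    fun f hf => presentedToHF_gen k D _⟩, ?_⟩
  have hs := isIntertwinerSystem_phi k D
  have hb := expand_weylHom_bijective k D
  choose word hred hword using D.cs.exists_isReduced
  have hphi : ∀ w, ((word w).map (HF.phi k D)).prod =
      ratToHF k D (normFactor k D (word w)) * hs.weylHom w := fun w => by
    rw [hs.prod_map_eq, ← hword]
  have h0 : ∀ w : D.W, ratToHF k D 0 * hs.weylHom w = 0 := fun w => by rw [map_zero, zero_mul]
  refine ⟨fun w => ((word w).map (HF.phi k D)).prod, fun ω hω => ?_, ?_, ?_⟩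
  · refine hs.prod_map_eq_of_isReduced hb.1 (t := weylHF k D) (fun r => ?_) hω (hred _) (hword _)
    rw [weylHF_simple, HF.phi_eq, add_sub_cancel_right]
  -- On the left, the coefficient of `φ_w` is multiplied by the factor between `φ_w` and the
  -- normalized element.
  · have h := bijective_sum_comp_equiv (A := fun w f => ratToHF k D f * hs.weylHom w) h0 hb
      (fun w => Equiv.mulRight₀ _ (normFactor_ne_zero (D := D) (word w))) fun w => zero_mul _
    refine (iff_of_eq (congrArg _ (funext fun c => Finsupp.sum_congr fun w _ => ?_))).mpr h
    generalize c w = f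
    change ratToHF k D f * ((word w).map (HF.phi k D)).prod =
      ratToHF k D (f * normFactor k D (word w)) * hs.weylHom w
    rw [hphi, ← mul_assoc, ← map_mul]
  -- On the right, moving the coefficient past `φ_w` applies `w` to it as well.
  · have h := bijective_sum_comp_equiv (A := fun w f => ratToHF k D f * hs.weylHom w) h0 hb
      (fun w => (ratAct k D w).toEquiv.trans
        (Equiv.mulLeft₀ _ (normFactor_ne_zero (D := D) (word w))))
      fun w => (congrArg _ (map_zero (ratAct k D w))).trans (mul_zero _)
    refine (iff_of_eq (congrArg _ (funext fun c => Finsupp.sum_congr fun w _ => ?_))).mpr h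
    generalize c w = f
    change ((word w).map (HF.phi k D)).prod * ratToHF k D f =
      ratToHF k D (normFactor k D (word w) * ratAct k D w f) * hs.weylHom w
    rw [hphi, mul_assoc, hs.weylHom_mul_rat, ← mul_assoc, ← map_mul]
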